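/- Let $m=n-1\ge 1$, and let $\mathrm{Cl}_{0,m}$ be the real Clifford algebra of $\mathbb R^{0,m}$ (scalar product $\langle v,w\rangle=-\sum_j v_jw_j$) with relation $v\cdot v=-\langle v,v\rangle$; so the standard basis vectors satisfy $e_j^2=1$ and anticommute. Let $S=S_{0,m}$ be a real irreducible $\mathrm{Cl}_{0,m}$-module, with representation $\rho:\mathrm{Cl}_{0,m}\to\mathrm{End}_{\mathbb R}(S)$. The Schur algebra $\mathcal C=\mathcal C_{0,m}$ consists of the endomorphisms of $S$ commuting with $\mathfrak{so}(m)$, i.e. with all $\rho(\tfrac14[v,w])$, $v,w\in\mathbb R^{0,m}$; the even Schur algebra $\mathcal C^\circ\subseteq\mathcal C$ consists of those elements that commute with all $\rho(v)$, $v\in\mathbb R^{0,m}$. An element $C\in\mathcal C$ has type $\tau(C)=-1$ if it anticommutes with all $\rho(v)$. Fix $1\le\iota\le m$. Embed $\mathrm{Cl}_{0,m-1}$ in $\mathrm{Cl}_{0,m}$ as the subalgebra generated by the $e_j$, $j\ne\iota$, let $\mathrm{Cl}^\circ_{0,m-1}$ be its even part and $\omega_{0,m-1}=e_1\cdots\widehat{e_\iota}\cdots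 e_m$ its volume form. Let $S^\pm$ be the $\pm1$-eigenspaces of $\rho(e_\iota)$. **Theorem 2.4.** One has $S=S^+\oplus S^-$, and both summands are non-zero if $m\ge2$. Let $\phi\in\mathrm{End}_{\mathbb R}(S)$ be $$\phi=\begin{cases}\rho(\omega_{0,m-1}) & \text{if } m\equiv 0 \pmod 2,\\ J & \text{if } m\equiv 3,7\pmod 8,\\ 0 & \text{if } m\equiv 1,5 \pmod 8,\end{cases}$$ where $J\in\mathcal C$ is any element of type $\tau(J)=-1$ which is a complex structure ($J^2=-\mathrm{Id}$) if $m\equiv3\pmod 8$, and a para-complex structure ($J^2=\mathrm{Id}$, with $\pm1$-eigenspaces of equal dimension) if $m\equiv 7\pmod 8$; such a $J$ exists. Then $\phi(S^\pm)\subseteq S^\mp$, and for every endomorphism $\varphi\in\mathrm{End}_{\mathbb R}(S)$ commuting with $\rho(\mathrm{Cl}^\circ_{0,m-1})$ there are $a,b,c,d\in\mathcal C^\circ$ such that, with respect to $S=S^+\oplus S^-$, $$\varphi=\begin{pmatrix} a & b\phi\\ c\phi & d\end{pmatrix}.$$ Here $a$ is uniquely determined by $\varphi$ if $S^+\neq0$,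 and $d$ is uniquely determined if $S^-\ne0$; so both are unique if $m\ge2$. If $m\not\equiv1\pmod 4$, then $b$ and $c$ are uniquely determined by $\varphi$ and $\phi$ as well. -/

import Mathlib

noncomputable section

namespace Spin

/-- The scalar square `⟨v, v⟩ = -(v₁² + ⋯ + v_m²)` of the space `ℝ^{0,m}` of signature `(0, m)`. -/
def scalarSquare (m : ℕ) : QuadraticForm ℝ (Fin m → ℝ) :=
  QuadraticMap.weightedSumSquares ℝ (fun _ : Fin m => (-1 : ℝ))

/-- The Clifford algebra `Cl_{0,m}`, with relation `v * v = -⟨v, v⟩`. -/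
abbrev Cl (m : ℕ) : Type := CliffordAlgebra (-(scalarSquare m))

/-- The embedding of `ℝ^{0,m}` in `Cl_{0,m}`. -/
def vec (m : ℕ) : (Fin m → ℝ) →ₗ[ℝ] Cl m := CliffordAlgebra.ι (-(scalarSquare m))

/-- The standard orthonormal vector `e_i`, as an element of `Cl_{0,m}`. -/
def e {m : ℕ} (i : Fin m) : Cl m := vec m (Pi.single i 1)

/-- The volume form `ω_{0,m} = e_1 ⋯ e_m`. -/
def volumeForm (m : ℕ) : Cl m := (List.ofFn (fun i : Fin m => e i)).prod

/-- The isometric embedding `ℝ^{0,k} → ℝ^{0,k+1}` onto the hyperplane `x_i = 0`. -/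
def hyperplane {k : ℕ} (i : Fin (k + 1)) :
    (-(scalarSquare k)) →qᵢ (-(scalarSquare (k + 1))) where
  toFun x := i.insertNth (0 : ℝ) x
  map_add' x y := by
    ext j
    refine Fin.succAboveCases i ?_ (fun l => ?_) j <;> simp
  map_smul' r x := by
    ext j
    refine Fin.succAboveCases i ?_ (fun l => ?_) j <;> simp
  map_app' x := by
    simp [scalarSquare, QuadraticMap.weightedSumSquares_apply, Fin.sum_univ_succAbove _ i]

/-- The induced embedding `Cl_{0,k} → Cl_{0,k+1}`, with image generated by the `e_j`, `j ≠ i`. -/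
def incl {k : ℕ} (i : Fin (k + 1)) : Cl k →ₐ[ℝ] Cl (k + 1) :=
  CliffordAlgebra.map (hyperplane i)

section Representation

variable (m : ℕ) (S : Type*) [AddCommGroup S] [Module ℝ S] [Module (Cl m) S]
  [IsScalarTower ℝ (Cl m) S]

/-- The representation `ρ_{0,m} : Cl_{0,m} → End_ℝ(S)`. -/
def rho : Cl m →ₐ[ℝ] Module.End ℝ S := Algebra.lsmul ℝ ℝ S

/-- The image `¼ [v, w]` in `Cl_{0,m}` of the element `v ∧ w` of `so(0, m)`. -/
def wedge (v w : Fin m → ℝ) : Cl m :=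
  (1 / 4 : ℝ) • (vec m v * vec m w - vec m w * vec m v)

/-- The Schur algebra `End_ℝ(S)^{so(0,m)}`. -/
def schurAlgebra : Subalgebra ℝ (Module.End ℝ S) :=
  Subalgebra.centralizer ℝ {T | ∃ v w : Fin m → ℝ, T = rho m S (wedge m v w)}

/-- The even Schur algebra: the elements of the Schur algebra that commute with Clifford
multiplication by vectors (type `τ = +1`). -/
def evenSchurAlgebra : Subalgebra ℝ (Module.End ℝ S) :=
  schurAlgebra m S ⊓ Subalgebra.centralizer ℝ (Set.range fun v => rho m S (vec m v))

variable {S}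

/-- The elements of the Schur algebra that anticommute with Clifford multiplication by vectors
(type `τ = -1`). -/
def IsOddSchur (C : Module.End ℝ S) : Prop :=
  C ∈ schurAlgebra m S ∧
    ∀ v : Fin m → ℝ, rho m S (vec m v) * C = -(C * rho m S (vec m v))

end Representation

section LinearAlgebra

variable {S : Type*} [AddCommGroup S] [Module ℝ S]

def IsComplexStructure (J : Module.End ℝ S) : Prop := J * J = -1

/-- An involution whose `±1`-eigenspaces have the same dimension. -/
def IsParaComplexStructure (J : Module.End ℝ S) : Prop :=
  J * J = 1 ∧ Module.rank ℝ (J.eigenspace 1) = Module.rank ℝ (J.eigenspace (-1))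

/-- `φ` is the block matrix `[[A, B], [C, D]]` with respect to the subspaces `P` and `N`:
`A : P → P`, `B : N → P`, `C : P → N`, `D : N → N`, where each of these maps is given as the
restriction of an endomorphism of `S`. -/
def IsBlockMatrix (P N : Submodule ℝ S) (φ A B C D : Module.End ℝ S) : Prop :=
  (∀ s ∈ P, A s ∈ P ∧ C s ∈ N ∧ φ s = A s + C s) ∧
    (∀ s ∈ N, B s ∈ P ∧ D s ∈ N ∧ φ s = B s + D s)

end LinearAlgebra

section Restriction

variable {k : ℕ} (i : Fin (k + 1)) (S : Type*) [AddCommGroup S] [Module ℝ S]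
  [Module (Cl (k + 1)) S] [IsScalarTower ℝ (Cl (k + 1)) S]

/-- The `+1`-eigenspace of `e_i` on `S`. -/
def posSpace : Submodule ℝ S := Module.End.eigenspace (rho (k + 1) S (e i)) 1

/-- The `-1`-eigenspace of `e_i` on `S`. -/
def negSpace : Submodule ℝ S := Module.End.eigenspace (rho (k + 1) S (e i)) (-1)

variable {S}

/-- Invariance under the even part of `Cl_{0,k}`, embedded in `Cl_{0,k+1}` by omitting `e_i`. -/
def IsInvariant (φ : Module.End ℝ S) : Prop :=
  ∀ c ∈ CliffordAlgebra.even (-(scalarSquare k)),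
    rho (k + 1) S (incl i c) * φ = φ * rho (k + 1) S (incl i c)

/-- The off-diagonal map `ϕ`, according to the residue of `k + 1`: the volume form of `Cl_{0,k}`,
or a complex or para-complex structure of type `τ = -1` in the Schur algebra, or zero. -/
def IsOffDiagonalMap (ϕ : Module.End ℝ S) : Prop :=
  ((k + 1) % 2 = 0 → ϕ = rho (k + 1) S (incl i (volumeForm k))) ∧
    ((k + 1) % 8 = 3 → IsOddSchur (k + 1) ϕ ∧ IsComplexStructure ϕ) ∧
    ((k + 1) % 8 = 7 → IsOddSchur (k + 1) ϕ ∧ IsParaComplexStructure ϕ) ∧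
    ((k + 1) % 8 = 1 ∨ (k + 1) % 8 = 5 → ϕ = 0)

end Restriction

end Spin

end

/-! Write `Q` for the projection of `S` to an eigenspace of `e_i`. The compression `Q φ Q` commutes
with `e_i` and with the even part of `Cl_{0,k}`; adding its conjugate by some `e_j`, `j ≠ i`,
extends it to an element of the even Schur algebra, and this gives the diagonal blocks. If `ϕ` is
invertible, the off-diagonal blocks of `φ` are diagonal blocks of `φ ϕ⁻¹`, multiplied by `ϕ`. In the
remaining case `k + 1 ≡ 1 (mod 4)`, the volume form of `Cl_{0,k+1}` acts as `±1`, so that `e_i` acts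
up to sign as an even element of `Cl_{0,k}`; then `φ` commutes with `e_i` and has no off-diagonal
blocks. Uniqueness holds because, `S` being irreducible, an element of the even Schur algebra which
kills a non-zero vector vanishes.

The endomorphism `J` is constructed for all signatures `(p, q)` of generators with square `1` and
`-1`. The product `w` of two generators of opposite square is an involution that commutes with all
other generators, which act irreducibly on its eigenspaces, so a `J` for `(p, q)` yields one for
`(p + 1, q + 1)`. Multiplying all generators but `a`, where `a² = 1`, by `a` relates `(q + 1, p)` to
`(p + 1, q)` and changes the sign of `J²`; multiplying four generators by their product relates
`(p, q + 4)` to `(p + 4, q)`. Everything then follows from the case `(0, 1)`, where `J` is complex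
conjugation.
-/

namespace Spin

open Module

section Anticommute

variable {R : Type*} [Ring R] {g w x y z K : R}

/-- `x` and `y` anticommute. Encoded through `SemiconjBy` so that its multiplication lemmas
apply. -/
def Anticommute (x y : R) : Prop := SemiconjBy x y (-y)

theorem anticommute_iff : Anticommute x y ↔ x * y = -(y * x) := by
  rw [Anticommute, SemiconjBy, neg_mul]

namespace Anticommute

theorem eq (h : Anticommute x y) : x * y = -(y * x) := anticommute_iff.1 h

theorem symm (h : Anticommute x y) : Anticommute y x := by
  rw [anticommute_iff, h.eq, neg_neg]

theorem neg_left (h : Anticommute x y) : Anticommute (-x) y := SemiconjBy.neg_left h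

theorem neg_right (h : Anticommute x y) : Anticommute x (-y) := SemiconjBy.neg_right h

theorem commute_mul_right (hy : Anticommute x y) (hz : Anticommute x z) : Commute x (y * z) := by
  have h := SemiconjBy.mul_right hy hz
  rwa [neg_mul_neg] at h

theorem commute_mul_left (hx : Anticommute x z) (hy : Anticommute y z) : Commute (x * y) z :=
  (hx.symm.commute_mul_right hy.symm).symm

theorem mul_right (hy : Anticommute x y) (hz : Commute x z) : Anticommute x (y * z) := by
  have h := SemiconjBy.mul_right hy hz
  rwa [neg_mul] at h

theorem mul_mul_self (h : Anticommute x y) : x * y * (x * y) = -(x * x * (y * y)) := by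
  rw [mul_assoc, ← mul_assoc y x y, h.symm.eq]
  noncomm_ring

theorem map {R' F : Type*} [Ring R'] [FunLike F R R'] [RingHomClass F R R'] (ψ : F)
    (h : Anticommute x y) : Anticommute (ψ x) (ψ y) := by
  rw [anticommute_iff, ← map_mul, h.eq, map_neg, map_mul]

end Anticommute

theorem anticommute_mul_right (hy : Commute x y) (hz : Anticommute x z) :
    Anticommute x (y * z) := by
  have h := SemiconjBy.mul_right hy hz
  rwa [mul_neg] at h

/-- The sum of `K` and its conjugate by an involution `g`, so that it commutes with `g`. It extends
a map on one half of a space to a map on the whole space when `g` exchanges the two halves. -/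
def symmetrize (g K : R) : R := K + g * K * g

theorem commute_symmetrize (hg : g * g = 1) (K : R) : Commute g (symmetrize g K) := by
  rw [Commute, SemiconjBy, symmetrize, mul_add, add_mul, mul_assoc _ g g, hg, mul_one,
    mul_assoc g K, ← mul_assoc g g, hg, one_mul, add_comm]

theorem Anticommute.commute_symmetrize (hg : Anticommute x g) (hK : Commute x K) :
    Commute x (symmetrize g K) :=
  hK.add_right ((hg.mul_right hK).commute_mul_right hg)

theorem Anticommute.symmetrize (hg : Anticommute x g) (hK : Anticommute x K) :
    Anticommute x (symmetrize g K) := by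
  have hgKg : Anticommute x (g * K * g) := anticommute_mul_right (hg.commute_mul_right hK) hg
  have h := SemiconjBy.add_right hK hgKg
  rwa [← neg_add] at h

theorem symmetrize_mul_self (hg : g * g = 1) (h : K * g * K = 0) :
    symmetrize g K * symmetrize g K = symmetrize g (K * K) := by
  calc symmetrize g K * symmetrize g K
      = K * K + K * g * K * g + g * (K * g * K) + g * K * (g * g) * K * g := by
        rw [symmetrize]; noncomm_ring
    _ = symmetrize g (K * K) := by rw [h, hg, symmetrize]; noncomm_ring

theorem neg_one_pow_mul_comm (n : ℕ) (x : R) : (-1) ^ n * x = x * (-1) ^ n :=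
  ((Commute.neg_one_left x).pow_left n).eq

theorem Anticommute.mul_list_prod {L : List R} (h : ∀ y ∈ L, Anticommute x y) :
    x * L.prod = (-1) ^ L.length * (L.prod * x) := by
  induction L with
  | nil => simp
  | cons y L ih =>
    rw [List.forall_mem_cons] at h
    calc x * (y :: L).prod = -(y * (x * L.prod)) := by
          rw [List.prod_cons, ← mul_assoc, h.1.eq, neg_mul, mul_assoc]
      _ = -(y * (-1) ^ L.length * (L.prod * x)) := by rw [ih h.2, mul_assoc]
      _ = (-1) ^ (y :: L).length * ((y :: L).prod * x) := by
          rw [← neg_one_pow_mul_comm, List.prod_cons, List.length_cons, pow_succ]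
          noncomm_ring

theorem mul_list_prod_of_mem {L : List R} (hL : L.Pairwise Anticommute) (hx : x ∈ L) :
    x * L.prod = (-1) ^ (L.length + 1) * (L.prod * x) := by
  obtain ⟨L₁, L₂, rfl⟩ := List.append_of_mem hx
  obtain ⟨-, h₂, h₁⟩ := List.pairwise_append.1 hL
  have hL₁ := Anticommute.mul_list_prod fun y hy => (h₁ y hy x List.mem_cons_self).symm
  have hL₂ := Anticommute.mul_list_prod (List.pairwise_cons.1 h₂).1
  calc x * (L₁ ++ x :: L₂).prod = (x * L₁.prod) * (x * L₂.prod) := by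
        rw [List.prod_append, List.prod_cons, mul_assoc]
    _ = (-1) ^ L₁.length * (L₁.prod * x * (-1) ^ L₂.length * (L₂.prod * x)) := by
        rw [hL₁, hL₂]
        simp only [mul_assoc]
    _ = (-1) ^ ((L₁ ++ x :: L₂).length + 1) * ((L₁ ++ x :: L₂).prod * x) := by
        rw [← neg_one_pow_mul_comm, List.prod_append, List.prod_cons, List.length_append,
          List.length_cons, ← add_assoc, pow_succ, pow_succ, pow_add]
        noncomm_ring

theorem list_prod_mul_self {L : List R} (hL : L.Pairwise Anticommute) (h : ∀ x ∈ L, x * x = 1) :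
    L.prod * L.prod = (-1) ^ (L.length.choose 2) := by
  induction L with
  | nil => simp
  | cons y L ih =>
    rw [List.pairwise_cons] at hL
    rw [List.forall_mem_cons] at h
    have hy := Anticommute.mul_list_prod hL.1
    have hLL := ih hL.2 h.2
    calc (y :: L).prod * (y :: L).prod = y * L.prod * y * L.prod := by
          rw [List.prod_cons]; noncomm_ring
      _ = (-1) ^ L.length * (L.prod * (y * y) * L.prod) := by rw [hy]; noncomm_ring
      _ = (-1) ^ (y :: L).length.choose 2 := by
          rw [h.1, mul_one, hLL, ← pow_add, List.length_cons, Nat.choose_succ_succ',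
            Nat.choose_one_right]

theorem list_prod_map_mul_left {L : List R} (h : ∀ y ∈ L, Anticommute w y) :
    (L.map (w * ·)).prod = (-1) ^ ((L.length + 1).choose 2) * (L.prod * w ^ L.length) := by
  induction L with
  | nil => simp
  | cons y L ih =>
    have hw := Anticommute.mul_list_prod h
    rw [List.forall_mem_cons] at h
    calc ((y :: L).map (w * ·)).prod
        = w * y * (-1) ^ (L.length + 1).choose 2 * (L.prod * w ^ L.length) := by
          rw [List.map_cons, List.prod_cons, ih h.2, mul_assoc (w * y)]
      _ = (-1) ^ (L.length + 1).choose 2 * (w * (y :: L).prod * w ^ L.length) := by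
          rw [← neg_one_pow_mul_comm, List.prod_cons]
          simp only [mul_assoc]
      _ = (-1) ^ ((y :: L).length + 1).choose 2 * ((y :: L).prod * w ^ (y :: L).length) := by
          rw [hw, List.length_cons, Nat.choose_succ_succ' (L.length + 1), Nat.choose_one_right,
            add_comm (L.length + 1) (Nat.choose _ _), pow_add _ (Nat.choose _ _), pow_succ' w]
          simp only [mul_assoc]

theorem commute_list_prod_of_even {L : List R} (hL : Even L.length)
    (h : ∀ y ∈ L, Anticommute x y) : Commute x L.prod := by
  rw [Commute, SemiconjBy, Anticommute.mul_list_prod h, hL.neg_one_pow, one_mul]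

theorem anticommute_list_prod_of_mem_of_even {L : List R} (hL : Even L.length)
    (h : L.Pairwise Anticommute) (hx : x ∈ L) : Anticommute x L.prod := by
  rw [anticommute_iff, mul_list_prod_of_mem h hx, hL.add_one.neg_one_pow, neg_one_mul]

theorem list_prod_mul_self_of_length_eq_four {L : List R} (hL : L.length = 4)
    (h : L.Pairwise Anticommute) (hpos : ∀ x ∈ L, x * x = 1) : L.prod * L.prod = 1 := by
  rw [list_prod_mul_self h hpos, hL]
  exact Even.neg_one_pow (by decide)

theorem list_prod_map_list_prod_mul_of_length_eq_four {L : List R} (hL : L.length = 4)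
    (h : L.Pairwise Anticommute) (hpos : ∀ x ∈ L, x * x = 1) :
    (L.map (L.prod * ·)).prod = L.prod := by
  have hprod := list_prod_mul_self_of_length_eq_four hL h hpos
  have hanti : ∀ x ∈ L, Anticommute L.prod x := fun x hx =>
    (anticommute_list_prod_of_mem_of_even (hL ▸ by decide) h hx).symm
  rw [list_prod_map_mul_left hanti, hL, Even.neg_one_pow (by decide), one_mul,
    pow_mul' L.prod 2 2, pow_two, pow_two, hprod, mul_one, mul_one]

theorem pairwise_anticommute_map_mul_left {L : List R} (hL : L.Pairwise Anticommute)
    (h : ∀ y ∈ L, Anticommute w y) : (L.map (w * ·)).Pairwise Anticommute := by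
  rw [List.pairwise_map]
  refine hL.imp_of_mem fun {x y} hx hy hxy => ?_
  have hwxw : Anticommute (w * x) w := (anticommute_mul_right (Commute.refl w) (h x hx)).symm
  exact hwxw.mul_right ((h y hy).commute_mul_left hxy)

end Anticommute

section Involution

variable {𝕜 V : Type*} [Field 𝕜] [AddCommGroup V] [Module 𝕜 V] {g w x P φ A C : End 𝕜 V}

/-- `½ (1 + w)`, the projection to the `1`-eigenspace of an involution `w`. -/
noncomputable def eigenProj (w : End 𝕜 V) : End 𝕜 V := (2 : 𝕜)⁻¹ • (1 + w)

theorem commute_eigenProj (h : Commute x w) : Commute x (eigenProj w) :=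
  ((Commute.one_right x).add_right h).smul_right _

theorem mul_eigenProj (hw : w * w = 1) : w * eigenProj w = eigenProj w := by
  rw [eigenProj, mul_smul_comm, mul_add, mul_one, hw, add_comm]

theorem eigenProj_mul (hw : w * w = 1) : eigenProj w * w = eigenProj w := by
  rw [← (commute_eigenProj (Commute.refl w)).eq, mul_eigenProj hw]

theorem eigenProj_mem_eigenspace (hw : w * w = 1) (v : V) : eigenProj w v ∈ w.eigenspace 1 := by
  rw [End.mem_eigenspace_iff, one_smul, ← End.mul_apply, mul_eigenProj hw]

theorem eigenProj_mul_eq_mul_eigenProj_neg (h : Anticommute w g) :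
    eigenProj w * g = g * eigenProj (-w) := by
  rw [eigenProj, eigenProj, smul_mul_assoc, mul_smul_comm, add_mul, mul_add, h.eq, mul_neg,
    one_mul, mul_one]

theorem eigenspace_neg (w : End 𝕜 V) (μ : 𝕜) : (-w).eigenspace μ = w.eigenspace (-μ) := by
  ext v
  rw [End.mem_eigenspace_iff, End.mem_eigenspace_iff, LinearMap.neg_apply, neg_smul,
    neg_eq_iff_eq_neg]

theorem mapsTo_eigenspace_of_commute (h : Commute w x) (μ : 𝕜) :
    Set.MapsTo x (w.eigenspace μ) (w.eigenspace μ) :=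
  End.mapsTo_genEigenspace_of_comm h μ 1

theorem mapsTo_eigenspace_neg_of_anticommute (h : Anticommute w x) (μ : 𝕜) :
    Set.MapsTo x (w.eigenspace μ) (w.eigenspace (-μ)) := by
  intro v hv
  have hwx : w (x v) = -x (w v) := congrArg (· v) h.eq
  rw [SetLike.mem_coe, End.mem_eigenspace_iff] at hv ⊢
  rw [hwx, hv, map_smul, neg_smul]

/-- `g` exchanges the two eigenspaces. -/
theorem rank_eigenspace_neg_of_anticommute (hg : g * g = 1) (h : Anticommute w g) (μ : 𝕜) :
    Module.rank 𝕜 (w.eigenspace μ) = Module.rank 𝕜 (w.eigenspace (-μ)) := by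
  have hgg (v : V) : g (g v) = v := congrArg (· v) hg
  have hμ := mapsTo_eigenspace_neg_of_anticommute h μ
  have hμ' := mapsTo_eigenspace_neg_of_anticommute h (-μ)
  rw [neg_neg] at hμ'
  exact (LinearEquiv.ofLinearMap (g.restrict hμ) (g.restrict hμ')
    (LinearMap.ext fun v => Subtype.ext (hgg v))
    (LinearMap.ext fun v => Subtype.ext (hgg v))).rank_eq

variable [NeZero (2 : 𝕜)]

theorem eigenProj_apply_of_mem {v : V} (hv : v ∈ w.eigenspace 1) : eigenProj w v = v := by
  rw [End.mem_eigenspace_iff, one_smul] at hv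
  rw [eigenProj, LinearMap.smul_apply, LinearMap.add_apply, End.one_apply, hv, ← two_smul 𝕜 v,
    inv_smul_smul₀ two_ne_zero]

theorem eigenProj_mul_self (hw : w * w = 1) : eigenProj w * eigenProj w = eigenProj w :=
  LinearMap.ext fun v => eigenProj_apply_of_mem (eigenProj_mem_eigenspace hw v)

theorem eigenProj_add_eigenProj_neg (w : End 𝕜 V) : eigenProj w + eigenProj (-w) = 1 := by
  rw [eigenProj, eigenProj, ← smul_add, show 1 + w + (1 + -w) = (2 : 𝕜) • 1 by rw [two_smul]; abel,
    inv_smul_smul₀ two_ne_zero]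

theorem eigenProj_mul_eigenProj_neg (hw : w * w = 1) : eigenProj w * eigenProj (-w) = 0 := by
  rw [eq_sub_of_add_eq' (eigenProj_add_eigenProj_neg w), mul_sub, mul_one, eigenProj_mul_self hw,
    sub_self]

theorem eigenProj_neg_mul_eigenProj (hw : w * w = 1) : eigenProj (-w) * eigenProj w = 0 := by
  have h := eigenProj_mul_eigenProj_neg (w := -w) (by rw [neg_mul_neg, hw])
  rwa [neg_neg] at h

theorem eigenProj_neg_mul_mul_eigenProj_of_commute (hw : w * w = 1) (h : Commute w x) :
    eigenProj (-w) * x * eigenProj w = 0 := by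
  rw [mul_assoc, (commute_eigenProj h.symm).eq, ← mul_assoc, eigenProj_neg_mul_eigenProj hw,
    zero_mul]

theorem eigenProj_mul_mul_eigenProj (hw : w * w = 1) (h : Anticommute w g) :
    eigenProj w * g * eigenProj w = 0 := by
  rw [eigenProj_mul_eq_mul_eigenProj_neg h, mul_assoc, eigenProj_neg_mul_eigenProj hw, mul_zero]

theorem symmetrize_mul_eigenProj (hg : g * g = 1) (h : Anticommute w g) (hgP : Commute g P) :
    symmetrize g (P * eigenProj w) = P := by
  calc symmetrize g (P * eigenProj w) = P * eigenProj w + P * g * (eigenProj w * g) := by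
        rw [symmetrize, ← mul_assoc g, hgP.eq, mul_assoc (P * g)]
    _ = P * (eigenProj w + g * g * eigenProj (-w)) := by
        rw [eigenProj_mul_eq_mul_eigenProj_neg h]; noncomm_ring
    _ = P := by rw [hg, one_mul, eigenProj_add_eigenProj_neg, mul_one]

theorem isCompl_eigenspace_one_neg_one (hw : w * w = 1) :
    IsCompl (w.eigenspace 1) (w.eigenspace (-1)) := by
  have hw' : -w * -w = 1 := by rw [neg_mul_neg, hw]
  rw [← eigenspace_neg]
  constructor
  · rw [Submodule.disjoint_def]
    intro v hv hv'
    rw [← eigenProj_apply_of_mem hv, ← eigenProj_apply_of_mem hv', ← End.mul_apply,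
      eigenProj_mul_eigenProj_neg hw, LinearMap.zero_apply]
  · rw [Submodule.codisjoint_iff_exists_add_eq]
    exact fun v => ⟨_, _, eigenProj_mem_eigenspace hw v, eigenProj_mem_eigenspace hw' v,
      congrArg (· v) (eigenProj_add_eigenProj_neg w)⟩

theorem eigenspace_one_ne_bot [Nontrivial V] (hw : w * w = 1) (hg : g * g = 1)
    (h : Anticommute w g) : w.eigenspace 1 ≠ ⊥ := by
  intro hbot
  have hproj : eigenProj w = 0 := LinearMap.ext fun v =>
    (Submodule.eq_bot_iff _).1 hbot _ (eigenProj_mem_eigenspace hw v)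
  have hone := symmetrize_mul_eigenProj hg h (Commute.one_right g)
  rw [hproj, symmetrize, mul_zero, mul_zero, zero_mul, add_zero] at hone
  exact zero_ne_one hone

theorem mem_eigenspace_and_eq_add_of_mul_eigenProj (hw : w * w = 1)
    (hA : A * eigenProj w = eigenProj w * φ * eigenProj w)
    (hC : C * eigenProj w = eigenProj (-w) * φ * eigenProj w) {v : V} (hv : v ∈ w.eigenspace 1) :
    A v ∈ w.eigenspace 1 ∧ C v ∈ w.eigenspace (-1) ∧ φ v = A v + C v := by
  have hQv : eigenProj w v = v := eigenProj_apply_of_mem hv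
  have hAv : A v = eigenProj w (φ v) := by
    have h := congrArg (· v) hA
    simpa only [End.mul_apply, hQv] using h
  have hCv : C v = eigenProj (-w) (φ v) := by
    have h := congrArg (· v) hC
    simpa only [End.mul_apply, hQv] using h
  rw [hAv, hCv, ← eigenspace_neg, ← LinearMap.add_apply, eigenProj_add_eigenProj_neg]
  exact ⟨eigenProj_mem_eigenspace hw _, eigenProj_mem_eigenspace (by rwa [neg_mul_neg]) _, rfl⟩

end Involution

section Conjugation

variable {𝕜 V : Type*} [Field 𝕜] [AddCommGroup V] [Module 𝕜 V] {a b g w x P K : End 𝕜 V}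
  {s : 𝕜} {A B F G : List (End 𝕜 V)} {W : Submodule 𝕜 V}

/-- Generators of a Clifford algebra acting on `V`: pairwise anticommuting endomorphisms, of square
`1` for those in `A` and of square `-1` for those in `B`. -/
structure IsCliffordPair (A B : List (End 𝕜 V)) : Prop where
  pos : ∀ x ∈ A, x * x = 1
  neg : ∀ x ∈ B, x * x = -1
  pairwise : (A ++ B).Pairwise Anticommute

/-- `P` is a non-zero idempotent commuting with `F`, and its image is irreducible under `F`.
Working in the image of `P`, rather than in a smaller space, keeps all maps in `End 𝕜 V`. -/
structure IsIrreducibleCorner (F : List (End 𝕜 V)) (P : End 𝕜 V) : Prop where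
  idem : P * P = P
  ne_zero : P ≠ 0
  comm : ∀ x ∈ F, Commute x P
  irr : ∀ W ≤ LinearMap.range P, (∀ x ∈ F, W ∈ End.invtSubmodule x) →
    W = ⊥ ∨ W = LinearMap.range P

/-- `K` is an endomorphism of the image of `P` that anticommutes with `F` and has square `s`. -/
structure IsConjugation (F : List (End 𝕜 V)) (P : End 𝕜 V) (s : 𝕜) (K : End 𝕜 V) : Prop where
  left : P * K = K
  right : K * P = K
  sq : K * K = s • P
  anti : ∀ x ∈ F, Anticommute K x

variable (V) in
/-- Every irreducible representation on a subspace of `V` of the Clifford algebra with `p`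
generators of square `1` and `q` generators of square `-1` carries an endomorphism of square `s`
anticommuting with all generators. -/
def HasConjugation (p q : ℕ) (s : 𝕜) : Prop :=
  ∀ A B : List (End 𝕜 V), A.length = p → B.length = q → IsCliffordPair A B →
    ∀ P, IsIrreducibleCorner (A ++ B) P → ∃ K, IsConjugation (A ++ B) P s K

theorem mem_invtSubmodule_of_mem_adjoin {X : Set (End 𝕜 V)}
    (h : ∀ y ∈ X, W ∈ End.invtSubmodule y) (hx : x ∈ Algebra.adjoin 𝕜 X) :
    W ∈ End.invtSubmodule x := by
  induction hx using Algebra.adjoin_induction with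
  | mem _ hx => exact h _ hx
  | algebraMap r => exact fun v hv => W.smul_mem r hv
  | add _ _ _ _ hx hy => exact fun v hv => W.add_mem (hx hv) (hy hv)
  | mul _ _ _ _ hx hy => exact fun v hv => hx (hy hv)

theorem mem_adjoin_of_mem (hx : x ∈ F) : x ∈ Algebra.adjoin 𝕜 {y | y ∈ F} :=
  Algebra.subset_adjoin hx

theorem IsIrreducibleCorner.of_adjoin (h : IsIrreducibleCorner F P)
    (hGF : ∀ x ∈ G, x ∈ Algebra.adjoin 𝕜 {y | y ∈ F})
    (hFG : ∀ x ∈ F, x ∈ Algebra.adjoin 𝕜 {y | y ∈ G}) : IsIrreducibleCorner G P where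
  idem := h.idem
  ne_zero := h.ne_zero
  comm x hx := (Algebra.commute_of_mem_adjoin_of_forall_mem_commute (hGF x hx) fun y hy =>
    (h.comm y hy).symm).symm
  irr W hWP hW := h.irr W hWP fun x hx => mem_invtSubmodule_of_mem_adjoin hW (hFG x hx)

theorem map_mem_invtSubmodule_of_commute (h : Commute x g) (hW : W ∈ End.invtSubmodule x) :
    W.map g ∈ End.invtSubmodule x := by
  rintro _ ⟨v, hv, rfl⟩
  exact ⟨x v, hW hv, congrArg (· v) h.symm.eq⟩

theorem map_mem_invtSubmodule_of_anticommute (h : Anticommute x g)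
    (hW : W ∈ End.invtSubmodule x) : W.map g ∈ End.invtSubmodule x := by
  rintro _ ⟨v, hv, rfl⟩
  exact ⟨-x v, neg_mem (hW hv), (map_neg g _).trans (congrArg (· v) h.eq).symm⟩

theorem sup_map_mem_invtSubmodule (hg : g * g = 1) (W : Submodule 𝕜 V) :
    W ⊔ W.map g ∈ End.invtSubmodule g := by
  rw [End.mem_invtSubmodule_iff_map_le, Submodule.map_sup, ← Submodule.map_comp,
    show g ∘ₗ g = LinearMap.id from hg, Submodule.map_id, sup_comm]

theorem exists_linearMap_eq_one_eq_zero {u v : V} (h : u ∉ 𝕜 ∙ v) :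
    ∃ l : V →ₗ[𝕜] 𝕜, l u = 1 ∧ l v = 0 := by
  obtain ⟨l, hu, hv⟩ := Submodule.exists_le_ker_of_notMem h
  exact ⟨(l u)⁻¹ • l, inv_mul_cancel₀ hu,
    by simp [LinearMap.mem_ker.1 (hv (Submodule.mem_span_singleton_self v))]⟩

theorem notMem_span_singleton_of_mul_self_eq_neg_one (h : ¬IsSquare (-1 : 𝕜))
    (hb : b * b = -1) {v : V} (hv : v ≠ 0) : v ∉ 𝕜 ∙ b v := by
  intro hmem
  obtain ⟨c, hc⟩ := Submodule.mem_span_singleton.1 hmem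
  have hbb : b (b v) = -v := congrArg (· v) hb
  have hbv : b v = -(c • v) := by rw [← smul_neg, ← hbb, ← map_smul, hc]
  have hcc : (c * c) • v = (-1 : 𝕜) • v := by
    rw [mul_smul, ← neg_neg (c • v), ← hbv, smul_neg, hc, neg_one_smul]
  exact h ⟨c, (smul_left_injective 𝕜 hv hcc).symm⟩

theorem IsIrreducibleCorner.mul_eq_of_commute {T : End 𝕜 V} (h : IsIrreducibleCorner F P)
    (hT : ∀ x ∈ F, Commute T x) {v : V} (hPv : P v = v) (hv : v ≠ 0) (hTv : T v = v) :
    T * P = P := by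
  have hvW : v ∈ LinearMap.range P ⊓ T.eigenspace 1 :=
    ⟨⟨v, hPv⟩, End.mem_eigenspace_iff.2 (hTv.trans (one_smul 𝕜 v).symm)⟩
  have hirr := h.irr (LinearMap.range P ⊓ T.eigenspace 1) inf_le_left fun x hx => by
    refine End.invtSubmodule.inf_mem ?_ (mapsTo_eigenspace_of_commute (hT x hx) 1)
    rw [← Submodule.map_top]
    exact map_mem_invtSubmodule_of_commute (h.comm x hx) (End.invtSubmodule.top_mem x)
  obtain hbot | htop := hirr
  · exact absurd ((Submodule.eq_bot_iff _).1 hbot v hvW) hv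
  · ext u
    simpa using End.mem_eigenspace_iff.1 (inf_eq_left.1 htop (LinearMap.mem_range_self P u))

theorem isConjugation_add_mul_mul {π : End 𝕜 V} (hb : b * b = -1) (hP : P * P = P)
    (hbP : b * P = P * b) (hPπ : P * π = π) (hππ : π * π = π) (hπbπ : π * b * π = 0)
    (hπP : (π - b * π * b) * P = P) :
    IsConjugation [b] P 1 ((π + b * π * b) * P) := by
  have hPK : P * (π + b * π * b) = π + b * π * b := by
    rw [mul_add, hPπ, ← mul_assoc, ← mul_assoc, ← hbP, mul_assoc b, hPπ]
  refine ⟨by rw [← mul_assoc, hPK], by rw [mul_assoc, hP], ?_, ?_⟩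
  · calc (π + b * π * b) * P * ((π + b * π * b) * P)
        = (π + b * π * b) * (π + b * π * b) * P := by
          rw [mul_assoc, ← mul_assoc P, hPK, ← mul_assoc]
      _ = (π * π + π * b * π * b + b * (π * b * π) + b * π * (b * b) * π * b) * P := by
          noncomm_ring
      _ = (π * π - b * (π * π) * b) * P := by rw [hπbπ, hb]; noncomm_ring
      _ = (1 : 𝕜) • P := by rw [hππ, hπP, one_smul]
  · simp only [List.forall_mem_singleton, anticommute_iff]
    calc (π + b * π * b) * P * b = (π * b + b * π * (b * b)) * P := by
          rw [mul_assoc, ← hbP]; noncomm_ring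
      _ = -((b * π + b * b * π * b) * P) := by rw [hb]; noncomm_ring
      _ = -(b * ((π + b * π * b) * P)) := by noncomm_ring

/-- With a rank one projection `π` onto `v`, `π - b π b` projects onto the complex line spanned by
`v` and `b v`, which is the whole corner, and `π + b π b` is the complex conjugation of this line
that fixes `v`. -/
theorem hasConjugation_zero_one (h : ¬IsSquare (-1 : 𝕜)) : HasConjugation V 0 1 (1 : 𝕜) := by
  intro A B hA hB hAB P hP
  obtain rfl := List.length_eq_zero_iff.1 hA
  obtain ⟨b, rfl⟩ := List.length_eq_one_iff.1 hB
  have hb : b * b = -1 := hAB.neg b List.mem_cons_self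
  have hbP : b * P = P * b := (hP.comm b List.mem_cons_self).eq
  obtain ⟨v, hPv, hv⟩ : ∃ v, P v = v ∧ v ≠ 0 := by
    obtain ⟨u, hu⟩ := DFunLike.ne_iff.1 hP.ne_zero
    exact ⟨P u, congrArg (· u) hP.idem, hu⟩
  obtain ⟨l, hlv, hlb⟩ := exists_linearMap_eq_one_eq_zero
    (notMem_span_singleton_of_mul_self_eq_neg_one h hb hv)
  set π : End 𝕜 V := l.smulRight v with hπ
  have hbπ : Commute (π - b * π * b) b := by
    rw [Commute, SemiconjBy, mul_sub, sub_mul, mul_assoc _ b b, hb, ← mul_assoc, ← mul_assoc, hb]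
    noncomm_ring
  have hπP : (π - b * π * b) * P = P :=
    hP.mul_eq_of_commute (by simpa using hbπ) hPv hv (by simp [hπ, hlv, hlb])
  exact ⟨_, isConjugation_add_mul_mul hb hP.idem hbP (by ext; simp [hπ, hPv])
    (by ext; simp [hπ, hlv]) (by ext; simp [hπ, hlb]) hπP⟩

theorem IsIrreducibleCorner.add_pair (h : IsIrreducibleCorner ((a :: A) ++ (b :: B)) P)
    (ha : a * a = 1) : IsIrreducibleCorner (a :: a * b :: (A ++ B)) P := by
  refine h.of_adjoin ?_ ?_
  · simp only [List.forall_mem_cons]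
    exact ⟨mem_adjoin_of_mem (by simp),
      mul_mem (mem_adjoin_of_mem (by simp)) (mem_adjoin_of_mem (by simp)),
      fun x hx => mem_adjoin_of_mem (by aesop)⟩
  · simp only [List.forall_mem_append, List.forall_mem_cons]
    refine ⟨⟨mem_adjoin_of_mem (by simp), fun x hx => mem_adjoin_of_mem (by simp [hx])⟩,
      ?_, fun x hx => mem_adjoin_of_mem (by simp [hx])⟩
    have hmem := mul_mem (mem_adjoin_of_mem (𝕜 := 𝕜) (List.mem_cons_self (l := a * b :: (A ++ B))))
      (mem_adjoin_of_mem (List.mem_cons_of_mem a List.mem_cons_self))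
    rwa [← mul_assoc, ha, one_mul] at hmem

theorem IsCliffordPair.flip (h : IsCliffordPair (a :: A) B) :
    IsCliffordPair (a :: B.map (a * ·)) (A.map (a * ·)) := by
  have ha : a * a = 1 := h.pos a List.mem_cons_self
  obtain ⟨hanti, hpair⟩ := List.pairwise_cons.1 h.pairwise
  refine ⟨?_, ?_, ?_⟩
  · simp only [List.forall_mem_cons, List.forall_mem_map]
    refine ⟨ha, fun x hx => ?_⟩
    rw [(hanti x (by simp [hx])).mul_mul_self, ha, h.neg x hx, one_mul, neg_neg]
  · simp only [List.forall_mem_map]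
    intro x hx
    rw [(hanti x (by simp [hx])).mul_mul_self, ha, h.pos x (by simp [hx]), one_mul]
  · rw [List.cons_append, ← List.map_append, List.pairwise_cons]
    have hanti' : ∀ x ∈ B ++ A, Anticommute a x := fun x hx => hanti x (by aesop)
    exact ⟨List.forall_mem_map.2 fun x hx => anticommute_mul_right (Commute.refl a) (hanti' x hx),
      pairwise_anticommute_map_mul_left ((List.pairwise_append_comm Anticommute.symm).1 hpair)
        hanti'⟩

theorem IsIrreducibleCorner.flip (h : IsIrreducibleCorner ((a :: A) ++ B) P) (ha : a * a = 1) :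
    IsIrreducibleCorner ((a :: B.map (a * ·)) ++ A.map (a * ·)) P := by
  refine h.of_adjoin ?_ ?_ <;>
    simp only [List.cons_append, ← List.map_append, List.forall_mem_cons, List.forall_mem_map] <;>
    refine ⟨mem_adjoin_of_mem (by simp), fun x hx => ?_⟩
  · exact mul_mem (mem_adjoin_of_mem (by simp)) (mem_adjoin_of_mem (by aesop))
  · rw [show x = a * (a * x) by rw [← mul_assoc, ha, one_mul]]
    exact mul_mem (mem_adjoin_of_mem (by simp)) (mem_adjoin_of_mem (by aesop))

theorem HasConjugation.flip {p q : ℕ} (h : HasConjugation V (q + 1) p s) :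
    HasConjugation V (p + 1) q (-s) := by
  intro A' B hA hB hAB P hP
  obtain ⟨a, A, rfl⟩ := List.exists_cons_of_length_eq_add_one hA
  have ha : a * a = 1 := hAB.pos a List.mem_cons_self
  have hanti : ∀ x ∈ A ++ B, Anticommute a x := (List.pairwise_cons.1 hAB.pairwise).1
  obtain ⟨K, hK⟩ := h (a :: B.map (a * ·)) (A.map (a * ·)) (by simpa using hB) (by simpa using hA)
    hAB.flip P (hP.flip ha)
  have haK : Anticommute a K := (hK.anti a (by simp)).symm
  refine ⟨a * K, ?_, ?_, ?_, ?_⟩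
  · rw [← mul_assoc, ← (hP.comm a (by simp)).eq, mul_assoc, hK.left]
  · rw [mul_assoc, hK.right]
  · rw [haK.mul_mul_self, ha, one_mul, hK.sq, neg_smul]
  · simp only [List.cons_append, List.forall_mem_cons]
    refine ⟨(anticommute_mul_right (Commute.refl a) haK).symm, fun x hx => ?_⟩
    have hKx : Commute K (a * (a * x)) :=
      haK.symm.commute_mul_right (hK.anti (a * x) (by aesop))
    rw [← mul_assoc, ha, one_mul] at hKx
    exact ((hanti x hx).symm.mul_right hKx.symm).symm

theorem IsCliffordPair.flip_four (h : IsCliffordPair (F ++ A) B) (hF : F.length = 4) :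
    IsCliffordPair A (F.map (F.prod * ·) ++ B) := by
  obtain ⟨hFF, hAB, hFAB⟩ := List.pairwise_append.1 (List.append_assoc F A B ▸ h.pairwise)
  have hF_even : Even F.length := hF ▸ by decide
  have hpos : ∀ x ∈ F, x * x = 1 := fun x hx => h.pos x (by simp [hx])
  have hanti : ∀ x ∈ F, Anticommute F.prod x := fun x hx =>
    (anticommute_list_prod_of_mem_of_even hF_even hFF hx).symm
  refine ⟨fun x hx => h.pos x (by simp [hx]), ?_, ?_⟩
  · simp only [List.forall_mem_append, List.forall_mem_map]
    refine ⟨fun x hx => ?_, h.neg⟩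
    rw [(hanti x hx).mul_mul_self, list_prod_mul_self_of_length_eq_four hF hFF hpos, hpos x hx,
      one_mul]
  · rw [(List.perm_append_comm_assoc A _ B).pairwise_iff Anticommute.symm, List.pairwise_append]
    refine ⟨pairwise_anticommute_map_mul_left hFF hanti, hAB, ?_⟩
    simp only [List.forall_mem_map]
    intro x hx y hy
    have hy_anti : ∀ z ∈ F, Anticommute y z := fun z hz => (hFAB z hz y hy).symm
    exact (anticommute_mul_right (commute_list_prod_of_even hF_even hy_anti) (hy_anti x hx)).symm

theorem IsIrreducibleCorner.flip_four (h : IsIrreducibleCorner (F ++ A ++ B) P)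
    (hF : F.length = 4) (hFF : F.Pairwise Anticommute) (hpos : ∀ x ∈ F, x * x = 1) :
    IsIrreducibleCorner (A ++ (F.map (F.prod * ·) ++ B)) P := by
  refine h.of_adjoin ?_ ?_ <;>
    simp only [List.forall_mem_append, List.forall_mem_map]
  · exact ⟨fun x hx => mem_adjoin_of_mem (by simp [hx]),
      fun x hx => mul_mem (list_prod_mem fun y hy => mem_adjoin_of_mem (by simp [hy]))
        (mem_adjoin_of_mem (by simp [hx])),
      fun x hx => mem_adjoin_of_mem (by simp [hx])⟩
  · refine ⟨⟨fun x hx => ?_, fun x hx => mem_adjoin_of_mem (by simp [hx])⟩,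
      fun x hx => mem_adjoin_of_mem (by simp [hx])⟩
    have hmem := mul_mem (list_prod_mem fun y hy => mem_adjoin_of_mem (𝕜 := 𝕜)
        (List.mem_append_right A (List.mem_append_left B hy)))
      (mem_adjoin_of_mem (List.mem_append_right A (List.mem_append_left B
        (List.mem_map_of_mem (f := (F.prod * ·)) hx))))
    rwa [list_prod_map_list_prod_mul_of_length_eq_four hF hFF hpos, ← mul_assoc,
      list_prod_mul_self_of_length_eq_four hF hFF hpos, one_mul] at hmem

theorem HasConjugation.flip_four {p q : ℕ} (h : HasConjugation V p (q + 4) s) :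
    HasConjugation V (p + 4) q s := by
  intro A' B hA hB hAB P hP
  obtain ⟨F, A, rfl, hF⟩ : ∃ F A, A' = F ++ A ∧ F.length = 4 :=
    ⟨A'.take 4, A'.drop 4, (List.take_append_drop 4 A').symm, by simp [hA]⟩
  have hFF : F.Pairwise Anticommute :=
    (List.pairwise_append.1 (List.pairwise_append.1 hAB.pairwise).1).1
  have hpos : ∀ x ∈ F, x * x = 1 := fun x hx => hAB.pos x (by simp [hx])
  have hA_length : A.length = p := by rw [List.length_append] at hA; omega
  have hB_length : (F.map (F.prod * ·) ++ B).length = q + 4 := by simp [hF, hB, add_comm]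
  obtain ⟨K, hK⟩ := h A _ hA_length hB_length (hAB.flip_four hF) P (hP.flip_four hF hFF hpos)
  have hKF : Commute K F.prod := by
    have hK_comm := commute_list_prod_of_even (x := K) (L := F.map (F.prod * ·))
      (by rw [List.length_map, hF]; decide) fun x hx => hK.anti x (by aesop)
    rwa [list_prod_map_list_prod_mul_of_length_eq_four hF hFF hpos] at hK_comm
  refine ⟨K, hK.left, hK.right, hK.sq, fun x hx => ?_⟩
  by_cases hxF : x ∈ F
  · have hKx := anticommute_mul_right hKF (hK.anti (F.prod * x) (by aesop))
    rwa [← mul_assoc, list_prod_mul_self_of_length_eq_four hF hFF hpos, one_mul] at hKx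
  · exact hK.anti x (by aesop)

variable [NeZero (2 : 𝕜)]

theorem range_mul_eigenProj (hP : P * P = P) (hw : w * w = 1) (hwP : Commute w P) :
    LinearMap.range (P * eigenProj w) = LinearMap.range P ⊓ w.eigenspace 1 := by
  have hPQ : Commute P (eigenProj w) := commute_eigenProj hwP.symm
  apply le_antisymm
  · rintro _ ⟨v, rfl⟩
    refine ⟨LinearMap.mem_range_self P _, ?_⟩
    rw [hPQ.eq]
    exact eigenProj_mem_eigenspace hw (P v)
  · rintro _ ⟨⟨v, rfl⟩, hv⟩
    refine ⟨P v, ?_⟩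
    rw [hPQ.eq, End.mul_apply, ← End.mul_apply P P, hP, eigenProj_apply_of_mem hv]

theorem sup_map_inf_eigenspace (hw : w * w = 1) (hwg : Anticommute w g)
    (hW : W ≤ w.eigenspace 1) : (W ⊔ W.map g) ⊓ w.eigenspace 1 = W := by
  refine le_antisymm ?_ (le_inf le_sup_left hW)
  have hgW : W.map g ≤ w.eigenspace (-1) := Submodule.map_le_iff_le_comap.2 fun v hv =>
    mapsTo_eigenspace_neg_of_anticommute hwg 1 (hW hv)
  rw [sup_inf_assoc_of_le _ hW, (isCompl_eigenspace_one_neg_one hw).symm.disjoint.mono_left hgW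
    |>.eq_bot, sup_bot_eq]

/-- If `W` is an invariant subspace of the half, then `W ⊔ g W` is one of the whole corner. -/
theorem IsIrreducibleCorner.half (h : IsIrreducibleCorner (g :: w :: F) P) (hg : g * g = 1)
    (hw : w * w = 1) (hwg : Anticommute w g) (hFg : ∀ x ∈ F, Anticommute x g)
    (hFw : ∀ x ∈ F, Commute x w) : IsIrreducibleCorner F (P * eigenProj w) := by
  have hgP : Commute g P := h.comm g (by simp)
  have hwP : Commute w P := h.comm w (by simp)
  have hPQ : Commute P (eigenProj w) := commute_eigenProj hwP.symm
  refine ⟨by rw [hPQ.symm.mul_mul_mul_comm, h.idem, eigenProj_mul_self hw],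
    fun h0 => h.ne_zero ?_,
    fun x hx => (h.comm x (by simp [hx])).mul_right (commute_eigenProj (hFw x hx)),
    fun W hWP hW => ?_⟩
  · rw [← symmetrize_mul_eigenProj hg hwg hgP, h0, symmetrize, mul_zero, zero_mul, add_zero]
  rw [range_mul_eigenProj h.idem hw hwP] at hWP ⊢
  obtain ⟨hWP, hWw⟩ := le_inf_iff.1 hWP
  have hgWP : W.map g ≤ LinearMap.range P := by
    rintro _ ⟨v, hv, rfl⟩
    obtain ⟨u, rfl⟩ := hWP hv
    exact ⟨g u, congrArg (· u) hgP.symm.eq⟩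
  have hwW : W ∈ End.invtSubmodule w := fun v hv => by
    rwa [Submodule.mem_comap, End.mem_eigenspace_iff.1 (hWw hv), one_smul]
  have hirr := h.irr (W ⊔ W.map g) (sup_le hWP hgWP) <| by
    simp only [List.forall_mem_cons]
    exact ⟨sup_map_mem_invtSubmodule hg W,
      End.invtSubmodule.sup_mem hwW (map_mem_invtSubmodule_of_anticommute hwg hwW),
      fun x hx => End.invtSubmodule.sup_mem (hW x hx)
        (map_mem_invtSubmodule_of_anticommute (hFg x hx) (hW x hx))⟩
  refine hirr.imp (fun hbot => (sup_eq_bot_iff.1 hbot).1) fun hrange => ?_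
  rw [← hrange, sup_map_inf_eigenspace hw hwg hWw]

theorem IsConjugation.symmetrize_mul_self (h : IsConjugation F (P * eigenProj w) s K)
    (ha : a * a = 1) (hw : w * w = 1) (hwa : Anticommute w a) (haP : Commute a P)
    (hwP : Commute w P) : symmetrize a K * symmetrize a K = s • P := by
  have hPQ : Commute P (eigenProj w) := commute_eigenProj hwP.symm
  have hQK : eigenProj w * K = K := by
    rw [← h.left, ← mul_assoc, ← mul_assoc, ← hPQ.eq, mul_assoc P, eigenProj_mul_self hw]
  have hKQ : K * eigenProj w = K := by
    rw [← h.right, mul_assoc, mul_assoc, eigenProj_mul_self hw]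
  have hKaK : K * a * K = 0 := by
    calc K * a * K = K * (eigenProj w * a * eigenProj w) * K := by
          rw [← mul_assoc K, ← mul_assoc K, hKQ, mul_assoc (K * a), hQK]
      _ = 0 := by rw [eigenProj_mul_mul_eigenProj hw hwa, mul_zero, zero_mul]
  rw [Spin.symmetrize_mul_self ha hKaK, h.sq, symmetrize, mul_smul_comm, smul_mul_assoc,
    ← smul_add, ← symmetrize, symmetrize_mul_eigenProj ha hwa haP]

/-- A conjugation `K` of a half is extended to the whole corner by `symmetrize a K`, which commutes
with `a` and `w`; the factor `w` corrects the sign on `a` and on `a * w`. -/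
theorem IsConjugation.mul_symmetrize (h : IsConjugation F (P * eigenProj w) s K)
    (ha : a * a = 1) (hw : w * w = 1) (hwa : Anticommute w a) (hP : P * P = P) (haP : Commute a P)
    (hwP : Commute w P) (hFa : ∀ x ∈ F, Anticommute x a) (hFw : ∀ x ∈ F, Commute x w) :
    IsConjugation (a :: a * w :: F) P s (w * symmetrize a K) := by
  have hPQ : Commute P (eigenProj w) := commute_eigenProj hwP.symm
  have hPK : P * K = K := by rw [← h.left, ← mul_assoc, ← mul_assoc, hP]
  have hKP : K * P = K := by rw [← h.right, hPQ.eq, mul_assoc, mul_assoc, hP]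
  have hPN : P * symmetrize a K = symmetrize a K := by
    rw [symmetrize, mul_add, ← mul_assoc, ← mul_assoc, ← haP.eq, mul_assoc a, hPK]
  have hNP : symmetrize a K * P = symmetrize a K := by
    rw [symmetrize, add_mul, mul_assoc _ a, haP.eq, ← mul_assoc, mul_assoc a, hKP]
  have hwK : w * K = K := by rw [← h.left, ← mul_assoc, hPQ.eq, ← mul_assoc, mul_eigenProj hw]
  have hKw : K * w = K := by rw [← h.right, mul_assoc, mul_assoc, eigenProj_mul hw]
  have hwN : Commute w (symmetrize a K) := hwa.commute_symmetrize (hwK.trans hKw.symm)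
  have hwJ : Commute w (w * symmetrize a K) := (Commute.refl w).mul_right hwN
  have haJ : Anticommute a (w * symmetrize a K) := hwa.symm.mul_right (commute_symmetrize ha K)
  refine ⟨by rw [← mul_assoc, ← hwP.eq, mul_assoc, hPN], by rw [mul_assoc, hNP],
    by rw [hwN.symm.mul_mul_mul_comm, hw, one_mul, h.symmetrize_mul_self ha hw hwa haP hwP], ?_⟩
  simp only [List.forall_mem_cons]
  refine ⟨haJ.symm, haJ.symm.mul_right hwJ.symm, fun x hx => ?_⟩
  exact (anticommute_mul_right (hFw x hx) ((hFa x hx).symmetrize (h.anti x hx).symm)).symm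

theorem HasConjugation.add_pair {p q : ℕ} (h : HasConjugation V p q s) :
    HasConjugation V (p + 1) (q + 1) s := by
  intro A' B' hA hB hAB P hP
  obtain ⟨a, A, rfl⟩ := List.exists_cons_of_length_eq_add_one hA
  obtain ⟨b, B, rfl⟩ := List.exists_cons_of_length_eq_add_one hB
  have ha : a * a = 1 := hAB.pos a List.mem_cons_self
  have hb : b * b = -1 := hAB.neg b List.mem_cons_self
  obtain ⟨hanti_a, hpair⟩ := List.pairwise_cons.1 hAB.pairwise
  obtain ⟨hanti_b, hpair⟩ := List.pairwise_cons.1 ((List.pairwise_middle Anticommute.symm).1 hpair)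
  have hab : Anticommute a b := hanti_a b (by simp)
  have hFa : ∀ x ∈ A ++ B, Anticommute x a := fun x hx => (hanti_a x (by aesop)).symm
  have hw : a * b * (a * b) = 1 := by rw [hab.mul_mul_self, ha, hb, one_mul, neg_neg]
  have hwa : Anticommute (a * b) a := (anticommute_mul_right (Commute.refl a) hab).symm
  have hFw : ∀ x ∈ A ++ B, Commute x (a * b) := fun x hx =>
    (hFa x hx).commute_mul_right (hanti_b x hx).symm
  have hcorner := hP.add_pair ha
  obtain ⟨K, hK⟩ := h A B (by simpa using hA) (by simpa using hB)
    ⟨fun x hx => hAB.pos x (by simp [hx]), fun x hx => hAB.neg x (by simp [hx]), hpair⟩ _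
    (hcorner.half ha hw hwa hFa hFw)
  have hJ := hK.mul_symmetrize ha hw hwa hP.idem (hcorner.comm a (by simp))
    (hcorner.comm (a * b) (by simp)) hFa hFw
  rw [← mul_assoc, ha, one_mul] at hJ
  exact ⟨_, hJ.left, hJ.right, hJ.sq, fun x hx => hJ.anti x (by aesop)⟩

theorem HasConjugation.add_eight {p q : ℕ} (h : HasConjugation V p q s) :
    HasConjugation V (p + 8) q s :=
  h.add_pair.add_pair.add_pair.add_pair.flip_four

theorem hasConjugation_seven_mod_eight (h : ¬IsSquare (-1 : 𝕜)) (l : ℕ) :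
    HasConjugation V (8 * l + 7) 0 (1 : 𝕜) := by
  induction l with
  | zero => exact (hasConjugation_zero_one h).add_pair.add_pair.add_pair.flip_four
  | succ l ih => exact ih.add_eight

theorem hasConjugation_three_mod_eight (h : ¬IsSquare (-1 : 𝕜)) (l : ℕ) :
    HasConjugation V (8 * l + 3) 0 (-1 : 𝕜) := by
  induction l with
  | zero => exact (hasConjugation_zero_one h).add_pair.flip
  | succ l ih => exact ih.add_eight

end Conjugation

section CliffordFamily

/-- Pairwise anticommuting involutions, that is, the images of the standard basis vectors under a
representation of `Cl_{0,m}`. -/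
structure IsCliffordFamily {ι R : Type*} [Ring R] (f : ι → R) : Prop where
  mul_self : ∀ j, f j * f j = 1
  anticommute : Pairwise fun j l => Anticommute (f j) (f l)

theorem IsCliffordFamily.neg {ι R : Type*} [Ring R] {f : ι → R} (h : IsCliffordFamily f) :
    IsCliffordFamily (-f) where
  mul_self j := by rw [Pi.neg_apply, neg_mul_neg, h.mul_self]
  anticommute _ _ hjl := (h.anticommute hjl).neg_left.neg_right

theorem IsCliffordFamily.map {ι R R' : Type*} [Ring R] [Ring R'] {f : ι → R}
    (h : IsCliffordFamily f) {F : Type*} [FunLike F R R'] [RingHomClass F R R'] (ψ : F) :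
    IsCliffordFamily (ψ ∘ f) where
  mul_self j := by rw [Function.comp_apply, ← map_mul, h.mul_self, map_one]
  anticommute _ _ hjl := (h.anticommute hjl).map ψ

variable {ι 𝕜 V : Type*} [Field 𝕜] [NeZero (2 : 𝕜)] [AddCommGroup V] [Module 𝕜 V]
  {f : ι → End 𝕜 V} {i : ι} {φ ϕ : End 𝕜 V}

/-- The compression `K` of `φ` commutes with `f i` and with all `f l * f j`, so that for any `j ≠ i`
its symmetrization by `f j` commutes with the whole family. -/
theorem IsCliffordFamily.exists_commute_mul_eigenProj (hf : IsCliffordFamily f)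
    (hφ : ∀ l ≠ i, ∀ j ≠ i, Commute (f l * f j) φ) :
    ∃ a, (∀ l, Commute (f l) a) ∧
      a * eigenProj (f i) = eigenProj (f i) * φ * eigenProj (f i) := by
  set Q := eigenProj (f i)
  set K := Q * φ * Q with hK
  have hQQ : Q * Q = Q := eigenProj_mul_self (hf.mul_self i)
  have hKQ : K * Q = K := by rw [hK, mul_assoc, hQQ]
  have hiK : Commute (f i) K := by
    rw [Commute, SemiconjBy, hK, mul_assoc Q φ, ← mul_assoc, mul_eigenProj (hf.mul_self i),
      ← mul_assoc, mul_assoc _ Q (f i), eigenProj_mul (hf.mul_self i)]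
  have hlK : ∀ l ≠ i, ∀ j ≠ i, Commute (f l * f j) K := fun l hl j hj => by
    have hQ : Commute (f l * f j) Q :=
      commute_eigenProj ((hf.anticommute hl).commute_mul_left (hf.anticommute hj))
    exact (hQ.mul_right (hφ l hl j hj)).mul_right hQ
  by_cases h : ∃ j, j ≠ i
  · obtain ⟨j, hj⟩ := h
    refine ⟨symmetrize (f j) K, fun l => ?_, ?_⟩
    · obtain rfl | hl := eq_or_ne l i
      · exact (hf.anticommute hj.symm).commute_symmetrize hiK
      obtain rfl | hlj := eq_or_ne l j
      · exact commute_symmetrize (hf.mul_self l) K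
      have hlj_anti : Anticommute (f l * f j) (f j) :=
        ((hf.anticommute hlj.symm).mul_right (Commute.refl (f j))).symm
      have hcomm := (hlj_anti.commute_symmetrize (hlK l hl j hj)).mul_left
        (commute_symmetrize (hf.mul_self j) K)
      rwa [mul_assoc, hf.mul_self, mul_one] at hcomm
    · rw [symmetrize, add_mul, hKQ, add_eq_left, hK]
      have hQjQ := eigenProj_mul_mul_eigenProj (hf.mul_self i) (hf.anticommute hj.symm)
      calc f j * (Q * φ * Q) * f j * Q = f j * Q * φ * (Q * f j * Q) := by
            simp only [mul_assoc]
        _ = 0 := by rw [hQjQ, mul_zero]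
  · push Not at h
    exact ⟨K, fun l => h l ▸ hiK, hKQ⟩

theorem IsCliffordFamily.exists_commute_mul_eigenProj_neg (hf : IsCliffordFamily f)
    (hφ : ∀ l ≠ i, ∀ j ≠ i, Commute (f l * f j) φ) :
    ∃ d, (∀ l, Commute (f l) d) ∧
      d * eigenProj (-f i) = eigenProj (-f i) * φ * eigenProj (-f i) := by
  obtain ⟨d, hd, hdQ⟩ := hf.neg.exists_commute_mul_eigenProj (i := i) (φ := φ) fun l hl j hj => by
    rw [Pi.neg_apply, Pi.neg_apply, neg_mul_neg]
    exact hφ l hl j hj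
  exact ⟨d, fun l => Commute.neg_left_iff.1 (hd l), hdQ⟩

/-- The off-diagonal block of `φ` is the diagonal block of `φ * ϕ⁻¹`, multiplied by `ϕ`. -/
theorem IsCliffordFamily.exists_commute_mul_mul_eigenProj (hf : IsCliffordFamily f)
    (hφ : ∀ l ≠ i, ∀ j ≠ i, Commute (f l * f j) φ) (hϕ : ∀ l ≠ i, ∀ j ≠ i, Commute (f l * f j) ϕ)
    (hiϕ : Anticommute (f i) ϕ) (hϕ_unit : IsUnit ϕ) :
    ∃ c, (∀ l, Commute (f l) c) ∧
      c * ϕ * eigenProj (f i) = eigenProj (-f i) * φ * eigenProj (f i) := by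
  obtain ⟨u, rfl⟩ := hϕ_unit
  have hswap := eigenProj_mul_eq_mul_eigenProj_neg hiϕ.neg_left
  rw [neg_neg] at hswap
  obtain ⟨c, hc, hcQ⟩ := hf.exists_commute_mul_eigenProj_neg (i := i)
    (φ := φ * ((u⁻¹ : (End 𝕜 V)ˣ) : End 𝕜 V))
    fun l hl j hj => (hφ l hl j hj).mul_right (hϕ l hl j hj).units_inv_right
  refine ⟨c, hc, ?_⟩
  calc c * u * eigenProj (f i) = c * eigenProj (-f i) * u := by
        rw [mul_assoc, ← hswap, mul_assoc]
    _ = eigenProj (-f i) * φ * (((u⁻¹ : (End 𝕜 V)ˣ) : End 𝕜 V) * (eigenProj (-f i) * u)) := by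
        rw [hcQ]; simp only [mul_assoc]
    _ = eigenProj (-f i) * φ * eigenProj (f i) := by rw [hswap, Units.inv_mul_cancel_left]

theorem IsCliffordFamily.exists_commute_mul_mul_eigenProj_neg (hf : IsCliffordFamily f)
    (hφ : ∀ l ≠ i, ∀ j ≠ i, Commute (f l * f j) φ) (hϕ : ∀ l ≠ i, ∀ j ≠ i, Commute (f l * f j) ϕ)
    (hiϕ : Anticommute (f i) ϕ) (hϕ_unit : IsUnit ϕ) :
    ∃ b, (∀ l, Commute (f l) b) ∧
      b * ϕ * eigenProj (-f i) = eigenProj (f i) * φ * eigenProj (-f i) := by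
  obtain ⟨b, hb, hbQ⟩ := hf.neg.exists_commute_mul_mul_eigenProj (i := i) (φ := φ)
    (fun l hl j hj => by rw [Pi.neg_apply, Pi.neg_apply, neg_mul_neg]; exact hφ l hl j hj)
    (fun l hl j hj => by rw [Pi.neg_apply, Pi.neg_apply, neg_mul_neg]; exact hϕ l hl j hj)
    hiϕ.neg_left hϕ_unit
  rw [Pi.neg_apply, neg_neg] at hbQ
  exact ⟨b, fun l => Commute.neg_left_iff.1 (hb l), hbQ⟩

end CliffordFamily

section Generators

variable {m k : ℕ}

theorem isCliffordFamily_e : IsCliffordFamily (e : Fin m → Cl m) where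
  mul_self j := by
    have h : (-(scalarSquare m)) (Pi.single j (1 : ℝ)) = 1 := by
      simp [scalarSquare, QuadraticMap.weightedSumSquares_apply, Pi.single_apply]
    rw [e, vec, CliffordAlgebra.ι_sq_scalar, h, map_one]
  anticommute j l hjl := by
    refine anticommute_iff.2 ?_
    rw [e, e, vec]
    apply CliffordAlgebra.ι_mul_ι_comm_of_isOrtho
    rw [QuadraticMap.isOrtho_def]
    simp only [scalarSquare, neg_apply, QuadraticMap.weightedSumSquares_apply, Pi.add_apply,
      smul_eq_mul, neg_mul, one_mul, Finset.sum_neg_distrib, neg_neg]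
    rw [← Finset.sum_add_distrib]
    refine Finset.sum_congr rfl fun x _ => ?_
    obtain rfl | hx := eq_or_ne x j
    · simp [hjl]
    · simp [hx]

theorem vec_eq_sum (v : Fin m → ℝ) : vec m v = ∑ j, v j • e j := by
  conv_lhs => rw [← (Pi.basisFun ℝ (Fin m)).sum_repr v]
  simp [e]

theorem adjoin_range_e : Algebra.adjoin ℝ (Set.range (e : Fin m → Cl m)) = ⊤ := by
  rw [eq_top_iff, ← CliffordAlgebra.adjoin_range_ι]
  refine Algebra.adjoin_le ?_
  rintro _ ⟨v, rfl⟩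
  change vec m v ∈ _
  rw [vec_eq_sum]
  exact sum_mem fun j _ => Subalgebra.smul_mem _ (Algebra.subset_adjoin (Set.mem_range_self j)) _

theorem pairwise_anticommute_ofFn_e : (List.ofFn (e : Fin m → Cl m)).Pairwise Anticommute :=
  List.pairwise_ofFn.2 fun _ _ hjl => isCliffordFamily_e.anticommute hjl.ne

theorem volumeForm_mul_self : volumeForm m * volumeForm m = (-1) ^ m.choose 2 := by
  rw [volumeForm, list_prod_mul_self pairwise_anticommute_ofFn_e, List.length_ofFn]
  simpa [List.mem_ofFn] using isCliffordFamily_e.mul_self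

theorem e_mul_volumeForm (j : Fin m) :
    e j * volumeForm m = (-1) ^ (m + 1) * (volumeForm m * e j) := by
  have hj : e j ∈ List.ofFn (e : Fin m → Cl m) := by simp [List.mem_ofFn]
  rw [volumeForm, mul_list_prod_of_mem pairwise_anticommute_ofFn_e hj, List.length_ofFn]

theorem volumeForm_mem_even (hk : Even k) :
    volumeForm k ∈ CliffordAlgebra.even (-(scalarSquare k)) := by
  have h := SetLike.list_prod_ofFn_mem_graded
    (A := CliffordAlgebra.evenOdd (-(scalarSquare k))) (fun _ : Fin k => 1) (fun j => e j)
    (fun j => CliffordAlgebra.ι_mem_evenOdd_one _ _)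
  rwa [List.sum_ofFn, Finset.sum_const, Finset.card_univ, Fintype.card_fin, nsmul_one,
    (ZMod.natCast_eq_zero_iff_even).2 hk] at h

theorem incl_e (i : Fin (k + 1)) (j : Fin k) : incl i (e j) = e (i.succAbove j) := by
  rw [incl, e, vec, CliffordAlgebra.map_apply_ι, e, vec]
  congr 1
  change (i.insertNth (0 : ℝ) (Pi.single j (1 : ℝ) : Fin k → ℝ) : Fin (k + 1) → ℝ) = _
  ext l
  refine Fin.succAboveCases i ?_ (fun l => ?_) l
  · simp
  · simp [Pi.single_apply]

theorem e_mul_incl_volumeForm (i : Fin (k + 1)) :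
    e i * incl i (volumeForm k) = (-1) ^ k * (incl i (volumeForm k) * e i) := by
  have h : ∀ y ∈ List.ofFn (incl i ∘ e), Anticommute (e i) y := by
    simp only [List.mem_ofFn, forall_exists_index, forall_apply_eq_imp_iff, Function.comp_apply,
      incl_e]
    exact fun j => isCliffordFamily_e.anticommute (Fin.succAbove_ne i j).symm
  rw [volumeForm, map_list_prod, List.map_ofFn, Anticommute.mul_list_prod h, List.length_ofFn]

theorem e_mul_incl_volumeForm_of_ne {i j : Fin (k + 1)} (hj : j ≠ i) :
    e j * incl i (volumeForm k) = (-1) ^ (k + 1) * (incl i (volumeForm k) * e j) := by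
  obtain ⟨j, rfl⟩ := Fin.exists_succAbove_eq hj
  rw [← incl_e, ← map_mul, e_mul_volumeForm, map_mul, map_mul, map_pow, map_neg, map_one]

theorem commute_e_incl_volumeForm (hk : Even k) (i : Fin (k + 1)) :
    Commute (e i) (incl i (volumeForm k)) := by
  rw [Commute, SemiconjBy, e_mul_incl_volumeForm, hk.neg_one_pow, one_mul]

theorem commute_e_incl_volumeForm_mul_e (hk : Even k) (i j : Fin (k + 1)) :
    Commute (e j) (incl i (volumeForm k) * e i) := by
  obtain rfl | hj := eq_or_ne j i
  · exact (commute_e_incl_volumeForm hk j).mul_right (Commute.refl _)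
  · have hanti : Anticommute (e j) (incl i (volumeForm k)) := by
      rw [anticommute_iff, e_mul_incl_volumeForm_of_ne hj, hk.add_one.neg_one_pow, neg_one_mul]
    exact hanti.commute_mul_right (isCliffordFamily_e.anticommute hj)

theorem even_choose_two_of_four_dvd (hk : 4 ∣ k) : Even (k.choose 2) := by
  obtain ⟨n, rfl⟩ := hk
  rw [Nat.choose_two_right, show 4 * n * (4 * n - 1) = 2 * (2 * n * (4 * n - 1)) by ring,
    Nat.mul_div_cancel_left _ two_pos, mul_assoc]
  exact even_two_mul _

end Generators

section Representation

variable {m : ℕ} {S : Type*} [AddCommGroup S] [Module ℝ S] [Module (Cl m) S]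
  [IsScalarTower ℝ (Cl m) S]

variable (S) in
/-- Clifford multiplication by the standard basis vector `e_j`. -/
noncomputable def gen (j : Fin m) : End ℝ S := rho m S (e j)

theorem isCliffordFamily_gen : IsCliffordFamily (gen S : Fin m → End ℝ S) :=
  isCliffordFamily_e.map (rho m S)

theorem rho_mem_adjoin_range_gen (c : Cl m) :
    rho m S c ∈ Algebra.adjoin ℝ (Set.range (gen S : Fin m → End ℝ S)) := by
  have hrange : Set.range (gen S : Fin m → End ℝ S) = rho m S '' Set.range e :=
    Set.range_comp (rho m S) e
  rw [hrange, ← AlgHom.map_adjoin, adjoin_range_e]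
  exact ⟨c, Algebra.mem_top, rfl⟩

theorem commute_rho_of_commute_gen {T : End ℝ S} (h : ∀ j : Fin m, Commute (gen S j) T)
    (c : Cl m) : Commute (rho m S c) T :=
  (Algebra.commute_of_mem_adjoin_of_forall_mem_commute (rho_mem_adjoin_range_gen c)
    (Set.forall_mem_range.2 fun j => (h j).symm)).symm

theorem mem_evenSchurAlgebra_iff {T : End ℝ S} :
    T ∈ evenSchurAlgebra m S ↔ ∀ j : Fin m, Commute (gen S j) T := by
  refine ⟨fun h j => (Subalgebra.mem_centralizer_iff ℝ).1 h.2 _ ⟨Pi.single j 1, rfl⟩, fun h => ?_⟩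
  refine ⟨(Subalgebra.mem_centralizer_iff ℝ).2 ?_, (Subalgebra.mem_centralizer_iff ℝ).2 ?_⟩
  · rintro _ ⟨v, w, rfl⟩
    exact commute_rho_of_commute_gen h _
  · rintro _ ⟨v, rfl⟩
    exact commute_rho_of_commute_gen h _

theorem isOddSchur_iff {T : End ℝ S} : IsOddSchur m T ↔ ∀ j : Fin m, Anticommute (gen S j) T := by
  refine ⟨fun h j => anticommute_iff.2 (h.2 (Pi.single j 1)), fun h => ?_⟩
  have hvec (v : Fin m → ℝ) : Anticommute (rho m S (vec m v)) T := by
    rw [anticommute_iff, vec_eq_sum, map_sum, Finset.sum_mul, Finset.mul_sum,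
      ← Finset.sum_neg_distrib]
    refine Finset.sum_congr rfl fun j _ => ?_
    rw [map_smul, ← gen, smul_mul_assoc, (h j).eq, mul_smul_comm, smul_neg]
  refine ⟨(Subalgebra.mem_centralizer_iff ℝ).2 ?_, fun v => (hvec v).eq⟩
  rintro _ ⟨v, w, rfl⟩
  rw [wedge, map_smul, map_sub, map_mul, map_mul]
  exact ((((hvec v).commute_mul_left (hvec w)).sub_left
    ((hvec w).commute_mul_left (hvec v))).smul_left _).eq

section Simple

variable [IsSimpleModule (Cl m) S]

theorem eq_bot_or_eq_top_of_mem_invtSubmodule {W : Submodule ℝ S}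
    (hW : ∀ j : Fin m, W ∈ End.invtSubmodule (gen S j)) : W = ⊥ ∨ W = ⊤ := by
  let U : Submodule (Cl m) S := { W with
    smul_mem' := fun c _ hs =>
      mem_invtSubmodule_of_mem_adjoin (Set.forall_mem_range.2 hW) (rho_mem_adjoin_range_gen c) hs }
  obtain h | h := eq_bot_or_eq_top U
  · exact Or.inl (SetLike.coe_injective (congrArg (fun T : Submodule (Cl m) S => (T : Set S)) h))
  · exact Or.inr (SetLike.coe_injective (congrArg (fun T : Submodule (Cl m) S => (T : Set S)) h))

theorem eq_zero_of_commute_of_apply_eq_zero {T : End ℝ S}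
    (hT : ∀ j : Fin m, Commute (gen S j) T) {s : S} (hs : s ≠ 0) (hTs : T s = 0) : T = 0 := by
  have hker := eq_bot_or_eq_top_of_mem_invtSubmodule (W := T.eigenspace 0) fun j =>
    mapsTo_eigenspace_of_commute (hT j).symm 0
  rw [End.eigenspace_zero] at hker
  exact hker.elim (fun hbot => absurd ((Submodule.eq_bot_iff _).1 hbot s hTs) hs)
    LinearMap.ker_eq_top.1

theorem eq_one_or_eq_neg_one_of_commute {z : End ℝ S} (hz : z * z = 1)
    (hc : ∀ j : Fin m, Commute (gen S j) z) : z = 1 ∨ z = -1 := by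
  by_contra! h
  obtain ⟨s, hs⟩ := DFunLike.ne_iff.1 (sub_ne_zero.2 h.1)
  have hzs : (z + 1) ((z - 1) s) = 0 := by
    rw [← End.mul_apply, show (z + 1) * (z - 1) = z * z - 1 by noncomm_ring, hz, sub_self,
      LinearMap.zero_apply]
  exact h.2 (eq_neg_of_add_eq_zero_left (eq_zero_of_commute_of_apply_eq_zero
    (fun j => (hc j).add_right (Commute.one_right _)) hs hzs))

theorem evenSchurAlgebra_eq_of_eqOn {a b : evenSchurAlgebra m S} {W : Submodule ℝ S}
    (hW : W ≠ ⊥) (h : ∀ s ∈ W, (a : End ℝ S) s = (b : End ℝ S) s) : a = b := by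
  obtain ⟨s, hs, hs0⟩ := Submodule.exists_mem_ne_zero_of_ne_bot hW
  exact Subtype.ext (sub_eq_zero.1 (eq_zero_of_commute_of_apply_eq_zero
    (mem_evenSchurAlgebra_iff.1 (sub_mem a.2 b.2)) hs0 (sub_eq_zero.2 (h s hs))))

theorem evenSchurAlgebra_eq_of_mul_eqOn {a b : evenSchurAlgebra m S} {ϕ : End ℝ S}
    (hϕ : IsUnit ϕ) {W : Submodule ℝ S} (hW : W ≠ ⊥)
    (h : ∀ s ∈ W, ((a : End ℝ S) * ϕ) s = ((b : End ℝ S) * ϕ) s) : a = b := by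
  have hmap_inj := Submodule.map_injective_of_injective ((End.isUnit_iff ϕ).1 hϕ).1
  refine evenSchurAlgebra_eq_of_eqOn (W := W.map ϕ) ?_ ?_
  · rwa [Ne, hmap_inj.eq_iff' (Submodule.map_bot ϕ)]
  · rintro _ ⟨s, hs, rfl⟩
    exact h s hs

variable (S) in
theorem HasConjugation.exists_isOddSchur {s : ℝ} (h : HasConjugation S m 0 s) :
    ∃ J : End ℝ S, IsOddSchur m J ∧ J * J = s • 1 := by
  have hpair : IsCliffordPair (List.ofFn (gen S (m := m))) ([] : List (End ℝ S)) := by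
    refine ⟨?_, by simp, ?_⟩
    · simpa [List.mem_ofFn] using isCliffordFamily_gen.mul_self
    · rw [List.append_nil, List.pairwise_ofFn]
      exact fun j l hjl => isCliffordFamily_gen.anticommute hjl.ne
  have : Nontrivial S := IsSimpleModule.nontrivial (Cl m) S
  obtain ⟨J, hJ⟩ := h _ [] List.length_ofFn rfl hpair 1 <| by
    refine ⟨mul_one 1, one_ne_zero, fun x _ => Commute.one_right x, fun W _ hW => ?_⟩
    rw [show LinearMap.range (1 : End ℝ S) = ⊤ from LinearMap.range_id]
    exact eq_bot_or_eq_top_of_mem_invtSubmodule fun j : Fin m => hW _ (by simp [List.mem_ofFn])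
  exact ⟨J, isOddSchur_iff.2 fun j => (hJ.anti _ (by simp [List.mem_ofFn])).symm, hJ.sq⟩

end Simple

end Representation

section BlockMatrix

variable {S : Type*} [AddCommGroup S] [Module ℝ S] {w φ A B C D : End ℝ S}

theorem isBlockMatrix_of_mul_eigenProj (hw : w * w = 1)
    (hA : A * eigenProj w = eigenProj w * φ * eigenProj w)
    (hB : B * eigenProj (-w) = eigenProj w * φ * eigenProj (-w))
    (hC : C * eigenProj w = eigenProj (-w) * φ * eigenProj w)
    (hD : D * eigenProj (-w) = eigenProj (-w) * φ * eigenProj (-w)) :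
    IsBlockMatrix (w.eigenspace 1) (w.eigenspace (-1)) φ A B C D := by
  refine ⟨fun s hs => mem_eigenspace_and_eq_add_of_mul_eigenProj hw hA hC hs, fun s hs => ?_⟩
  rw [← eigenspace_neg] at hs
  obtain ⟨hDs, hBs, hφs⟩ := mem_eigenspace_and_eq_add_of_mul_eigenProj (C := B)
    (by rwa [neg_mul_neg]) hD (by rwa [neg_neg]) hs
  rw [eigenspace_neg] at hDs hBs
  rw [neg_neg] at hBs
  exact ⟨hBs, hDs, by rw [hφs, add_comm]⟩

theorem IsBlockMatrix.unique {P N : Submodule ℝ S} (h : Disjoint P N) {A' B' C' D' : End ℝ S}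
    (h₁ : IsBlockMatrix P N φ A B C D) (h₂ : IsBlockMatrix P N φ A' B' C' D') :
    (∀ s ∈ P, A s = A' s ∧ C s = C' s) ∧ ∀ s ∈ N, B s = B' s ∧ D s = D' s := by
  have hadd : ∀ x ∈ P, ∀ y ∈ N, ∀ x' ∈ P, ∀ y' ∈ N, x + y = x' + y' → x = x' ∧ y = y' := by
    intro x hx y hy x' hx' y' hy' hxy
    have hsub : (x - x') + (y - y') = 0 := by rw [sub_add_sub_comm, hxy, sub_self]
    simpa only [sub_eq_zero] using
      (Submodule.disjoint_iff_add_eq_zero.1 h) (sub_mem hx hx') (sub_mem hy hy') hsub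
  refine ⟨fun s hs => ?_, fun s hs => ?_⟩
  · obtain ⟨hA, hC, hφ⟩ := h₁.1 s hs
    obtain ⟨hA', hC', hφ'⟩ := h₂.1 s hs
    exact hadd _ hA _ hC _ hA' _ hC' (hφ.symm.trans hφ')
  · obtain ⟨hB, hD, hφ⟩ := h₁.2 s hs
    obtain ⟨hB', hD', hφ'⟩ := h₂.2 s hs
    exact hadd _ hB _ hD _ hB' _ hD' (hφ.symm.trans hφ')

end BlockMatrix

section Restriction

variable {k : ℕ} {i : Fin (k + 1)} {S : Type*} [AddCommGroup S] [Module ℝ S]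
  [Module (Cl (k + 1)) S] [IsScalarTower ℝ (Cl (k + 1)) S] {ϕ φ : End ℝ S}

variable (i S) in
theorem isCompl_posSpace_negSpace : IsCompl (posSpace i S) (negSpace i S) :=
  isCompl_eigenspace_one_neg_one (isCliffordFamily_gen.mul_self i)

theorem posSpace_ne_bot_and_negSpace_ne_bot [Nontrivial S] (hk : 1 ≤ k) :
    posSpace i S ≠ ⊥ ∧ negSpace i S ≠ ⊥ := by
  have hgen : IsCliffordFamily (gen S : Fin (k + 1) → End ℝ S) := isCliffordFamily_gen
  have : Nontrivial (Fin (k + 1)) := Fin.nontrivial_iff_two_le.2 (by omega)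
  obtain ⟨j, hj⟩ := exists_ne i
  have hij := hgen.anticommute hj.symm
  refine ⟨eigenspace_one_ne_bot (hgen.mul_self i) (hgen.mul_self j) hij, ?_⟩
  rw [negSpace, ← gen, ← eigenspace_neg]
  exact eigenspace_one_ne_bot (hgen.neg.mul_self i) (hgen.mul_self j) hij.neg_left

theorem IsInvariant.commute_gen_mul_gen (h : IsInvariant i φ) :
    ∀ l ≠ i, ∀ j ≠ i, Commute (gen S l * gen S j) φ := by
  intro l hl j hj
  obtain ⟨l, rfl⟩ := Fin.exists_succAbove_eq hl
  obtain ⟨j, rfl⟩ := Fin.exists_succAbove_eq hj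
  have hlj := h (e l * e j) (CliffordAlgebra.ι_mul_ι_mem_evenOdd_zero _ _ _)
  rwa [map_mul, map_mul, incl_e, incl_e] at hlj

variable (i S) in
theorem exists_isOffDiagonalMap [IsSimpleModule (Cl (k + 1)) S] :
    ∃ ϕ : End ℝ S, IsOffDiagonalMap i ϕ := by
  have hsq : ¬IsSquare (-1 : ℝ) := fun h => by linarith [h.nonneg]
  by_cases h2 : (k + 1) % 2 = 0
  · exact ⟨_, fun _ => rfl, by omega, by omega, by omega⟩
  by_cases h3 : (k + 1) % 8 = 3
  · have hconj := hasConjugation_three_mod_eight (V := S) hsq ((k + 1) / 8)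
    rw [show 8 * ((k + 1) / 8) + 3 = k + 1 by omega] at hconj
    obtain ⟨J, hJ, hJJ⟩ := hconj.exists_isOddSchur S
    rw [neg_one_smul] at hJJ
    exact ⟨J, by omega, fun _ => ⟨hJ, hJJ⟩, by omega, by omega⟩
  by_cases h7 : (k + 1) % 8 = 7
  · have hconj := hasConjugation_seven_mod_eight (V := S) hsq ((k + 1) / 8)
    rw [show 8 * ((k + 1) / 8) + 7 = k + 1 by omega] at hconj
    obtain ⟨J, hJ, hJJ⟩ := hconj.exists_isOddSchur S
    rw [one_smul] at hJJ
    have hrank := rank_eigenspace_neg_of_anticommute (isCliffordFamily_gen.mul_self i)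
      (isOddSchur_iff.1 hJ i).symm 1
    exact ⟨J, by omega, by omega, fun _ => ⟨hJ, hJJ, hrank⟩, by omega⟩
  · exact ⟨0, by omega, by omega, by omega, fun _ => rfl⟩

namespace IsOffDiagonalMap

theorem anticommute_gen_of_odd (h : IsOffDiagonalMap i ϕ) (hk : Odd (k + 1)) (j : Fin (k + 1)) :
    Anticommute (gen S j) ϕ := by
  rw [Nat.odd_iff] at hk
  obtain h15 | h3 | h7 : ((k + 1) % 8 = 1 ∨ (k + 1) % 8 = 5) ∨ (k + 1) % 8 = 3 ∨ (k + 1) % 8 = 7 :=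
    by omega
  · rw [h.2.2.2 h15, anticommute_iff, mul_zero, zero_mul, neg_zero]
  · exact isOddSchur_iff.1 (h.2.1 h3).1 j
  · exact isOddSchur_iff.1 (h.2.2.1 h7).1 j

theorem anticommute_gen (h : IsOffDiagonalMap i ϕ) : Anticommute (gen S i) ϕ := by
  obtain hk | hk := Nat.even_or_odd (k + 1)
  · rw [h.1 (Nat.even_iff.1 hk)]
    have hk_odd : Odd k := Nat.not_even_iff_odd.1 (Nat.even_add_one.1 hk)
    refine Anticommute.map (rho (k + 1) S) (anticommute_iff.2 ?_)
    rw [e_mul_incl_volumeForm, hk_odd.neg_one_pow, neg_one_mul]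
  · exact h.anticommute_gen_of_odd hk i

theorem commute_gen_mul_gen (h : IsOffDiagonalMap i ϕ) :
    ∀ l ≠ i, ∀ j ≠ i, Commute (gen S l * gen S j) ϕ := by
  intro l hl j hj
  obtain hk | hk := Nat.even_or_odd (k + 1)
  · rw [h.1 (Nat.even_iff.1 hk)]
    have hcomm : ∀ j ≠ i, Commute (e j) (incl i (volumeForm k)) := fun j hj => by
      rw [Commute, SemiconjBy, e_mul_incl_volumeForm_of_ne hj, hk.neg_one_pow, one_mul]
    exact ((hcomm l hl).map (rho (k + 1) S)).mul_left ((hcomm j hj).map (rho (k + 1) S))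
  · exact (h.anticommute_gen_of_odd hk l).commute_mul_left (h.anticommute_gen_of_odd hk j)

theorem isUnit (h : IsOffDiagonalMap i ϕ) (hk : (k + 1) % 4 ≠ 1) : IsUnit ϕ := by
  suffices hsq : IsUnit (ϕ * ϕ) from ((Commute.refl ϕ).isUnit_mul_iff.1 hsq).1
  obtain h2 | h3 | h7 : (k + 1) % 2 = 0 ∨ (k + 1) % 8 = 3 ∨ (k + 1) % 8 = 7 := by omega
  · rw [h.1 h2, ← map_mul, ← map_mul, volumeForm_mul_self]
    exact ((isUnit_one.neg.pow _).map (incl i)).map (rho (k + 1) S)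
  · rw [show ϕ * ϕ = -1 from (h.2.1 h3).2]
    exact isUnit_one.neg
  · rw [(h.2.2.1 h7).2.1]
    exact isUnit_one

end IsOffDiagonalMap

/-- For `k + 1 ≡ 1 (mod 4)` the volume form of `Cl_{0,k+1}` is central of square `1`, so that `e_i`
acts, up to sign, as the volume form of `Cl_{0,k}`, which is even. -/
theorem IsInvariant.commute_gen [IsSimpleModule (Cl (k + 1)) S] (h : IsInvariant i φ)
    (hk : (k + 1) % 4 = 1) : Commute (gen S i) φ := by
  have hk4 : 4 ∣ k := by omega
  have hk_even : Even k := even_iff_two_dvd.2 (dvd_trans (by norm_num) hk4)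
  set ω := rho (k + 1) S (incl i (volumeForm k)) with hω
  have hωφ : Commute ω φ := h _ (volumeForm_mem_even hk_even)
  have hωω : ω * ω = 1 := by
    rw [hω, ← map_mul, ← map_mul, volumeForm_mul_self,
      (even_choose_two_of_four_dvd hk4).neg_one_pow, map_one, map_one]
  have hcentral : ∀ j, Commute (gen S j) (ω * gen S i) := fun j => by
    have hj := (commute_e_incl_volumeForm_mul_e hk_even i j).map (rho (k + 1) S)
    rwa [map_mul] at hj
  have hωi : Commute ω (gen S i) :=
    ((commute_e_incl_volumeForm hk_even i).map (rho (k + 1) S)).symm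
  have hz : ω * gen S i * (ω * gen S i) = 1 := by
    rw [hωi.symm.mul_mul_mul_comm, hωω, isCliffordFamily_gen.mul_self, one_mul]
  have hgen : gen S i = ω * (ω * gen S i) := by rw [← mul_assoc, hωω, one_mul]
  obtain hone | hneg := eq_one_or_eq_neg_one_of_commute hz hcentral
  · rwa [hgen, hone, mul_one]
  · rw [hgen, hneg, mul_neg_one]
    exact hωφ.neg_left

/-- For `k + 1 ≡ 1 (mod 4)` the off-diagonal blocks vanish; otherwise `ϕ` is invertible. -/
theorem IsInvariant.exists_mul_mul_eigenProj [IsSimpleModule (Cl (k + 1)) S]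
    (hϕ : IsOffDiagonalMap i ϕ) (hφ : IsInvariant i φ) :
    ∃ b c : evenSchurAlgebra (k + 1) S,
      (b : End ℝ S) * ϕ * eigenProj (-gen S i) =
          eigenProj (gen S i) * φ * eigenProj (-gen S i) ∧
        (c : End ℝ S) * ϕ * eigenProj (gen S i) =
          eigenProj (-gen S i) * φ * eigenProj (gen S i) := by
  have hgen : IsCliffordFamily (gen S : Fin (k + 1) → End ℝ S) := isCliffordFamily_gen
  by_cases hk : (k + 1) % 4 = 1
  · have hcomm := hφ.commute_gen hk
    have hpos := eigenProj_neg_mul_mul_eigenProj_of_commute (hgen.mul_self i) hcomm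
    have hneg := eigenProj_neg_mul_mul_eigenProj_of_commute (hgen.neg.mul_self i) hcomm.neg_left
    rw [Pi.neg_apply, neg_neg] at hneg
    refine ⟨0, 0, ?_, ?_⟩
    · rw [hneg, ZeroMemClass.coe_zero, zero_mul, zero_mul]
    · rw [hpos, ZeroMemClass.coe_zero, zero_mul, zero_mul]
  · obtain ⟨b, hb, hbQ⟩ := hgen.exists_commute_mul_mul_eigenProj_neg hφ.commute_gen_mul_gen
      hϕ.commute_gen_mul_gen hϕ.anticommute_gen (hϕ.isUnit hk)
    obtain ⟨c, hc, hcQ⟩ := hgen.exists_commute_mul_mul_eigenProj hφ.commute_gen_mul_gen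
      hϕ.commute_gen_mul_gen hϕ.anticommute_gen (hϕ.isUnit hk)
    exact ⟨⟨b, mem_evenSchurAlgebra_iff.2 hb⟩, ⟨c, mem_evenSchurAlgebra_iff.2 hc⟩, hbQ, hcQ⟩

theorem IsInvariant.exists_isBlockMatrix [IsSimpleModule (Cl (k + 1)) S]
    (hϕ : IsOffDiagonalMap i ϕ) (hφ : IsInvariant i φ) :
    ∃ a b c d : evenSchurAlgebra (k + 1) S, IsBlockMatrix (posSpace i S) (negSpace i S) φ
      (a : End ℝ S) ((b : End ℝ S) * ϕ) ((c : End ℝ S) * ϕ) (d : End ℝ S) := by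
  have hgen : IsCliffordFamily (gen S : Fin (k + 1) → End ℝ S) := isCliffordFamily_gen
  obtain ⟨a, ha, haQ⟩ := hgen.exists_commute_mul_eigenProj hφ.commute_gen_mul_gen
  obtain ⟨d, hd, hdQ⟩ := hgen.exists_commute_mul_eigenProj_neg hφ.commute_gen_mul_gen
  obtain ⟨b, c, hbQ, hcQ⟩ := hφ.exists_mul_mul_eigenProj hϕ
  exact ⟨⟨a, mem_evenSchurAlgebra_iff.2 ha⟩, b, c, ⟨d, mem_evenSchurAlgebra_iff.2 hd⟩,
    isBlockMatrix_of_mul_eigenProj (hgen.mul_self i) haQ hbQ hcQ hdQ⟩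

theorem IsOffDiagonalMap.unique_isBlockMatrix [IsSimpleModule (Cl (k + 1)) S]
    (hϕ : IsOffDiagonalMap i ϕ) {a b c d a' b' c' d' : evenSchurAlgebra (k + 1) S}
    (h : IsBlockMatrix (posSpace i S) (negSpace i S) φ
      (a : End ℝ S) ((b : End ℝ S) * ϕ) ((c : End ℝ S) * ϕ) (d : End ℝ S))
    (h' : IsBlockMatrix (posSpace i S) (negSpace i S) φ
      (a' : End ℝ S) ((b' : End ℝ S) * ϕ) ((c' : End ℝ S) * ϕ) (d' : End ℝ S)) :
    (posSpace i S ≠ ⊥ → a = a') ∧ (negSpace i S ≠ ⊥ → d = d') ∧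
      ((k + 1) % 4 ≠ 1 → b = b' ∧ c = c') := by
  have : Nontrivial S := IsSimpleModule.nontrivial (Cl (k + 1)) S
  obtain ⟨hpos, hneg⟩ := h.unique (isCompl_posSpace_negSpace i S).disjoint h'
  refine ⟨fun hP => evenSchurAlgebra_eq_of_eqOn hP fun s hs => (hpos s hs).1,
    fun hN => evenSchurAlgebra_eq_of_eqOn hN fun s hs => (hneg s hs).2, fun hk => ?_⟩
  obtain ⟨hP, hN⟩ := posSpace_ne_bot_and_negSpace_ne_bot (i := i) (S := S) (by omega)
  have hϕ_unit := hϕ.isUnit hk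
  exact ⟨evenSchurAlgebra_eq_of_mul_eqOn hϕ_unit hN fun s hs => (hneg s hs).1,
    evenSchurAlgebra_eq_of_mul_eqOn hϕ_unit hP fun s hs => (hpos s hs).2⟩

end Restriction

end Spin

theorem theorem2p4 (k : ℕ) (i : Fin (k + 1)) (S : Type*) [AddCommGroup S] [Module ℝ S]
    [Module (Spin.Cl (k + 1)) S] [IsScalarTower ℝ (Spin.Cl (k + 1)) S]
    [IsSimpleModule (Spin.Cl (k + 1)) S] :
    IsCompl (Spin.posSpace i S) (Spin.negSpace i S) ∧
    (1 ≤ k → Spin.posSpace i S ≠ ⊥ ∧ Spin.negSpace i S ≠ ⊥) ∧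
    (∃ ϕ : Module.End ℝ S, Spin.IsOffDiagonalMap i ϕ) ∧
    ∀ ϕ : Module.End ℝ S, Spin.IsOffDiagonalMap i ϕ →
      (∀ s ∈ Spin.posSpace i S, ϕ s ∈ Spin.negSpace i S) ∧
      (∀ s ∈ Spin.negSpace i S, ϕ s ∈ Spin.posSpace i S) ∧
      ∀ φ : Module.End ℝ S, Spin.IsInvariant i φ →
        (∃ a b c d : Spin.evenSchurAlgebra (k + 1) S,
          Spin.IsBlockMatrix (Spin.posSpace i S) (Spin.negSpace i S) φ
            (a : Module.End ℝ S) ((b : Module.End ℝ S) * ϕ)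
            ((c : Module.End ℝ S) * ϕ) (d : Module.End ℝ S)) ∧
        (∀ a b c d a' b' c' d' : Spin.evenSchurAlgebra (k + 1) S,
          Spin.IsBlockMatrix (Spin.posSpace i S) (Spin.negSpace i S) φ
            (a : Module.End ℝ S) ((b : Module.End ℝ S) * ϕ)
            ((c : Module.End ℝ S) * ϕ) (d : Module.End ℝ S) →
          Spin.IsBlockMatrix (Spin.posSpace i S) (Spin.negSpace i S) φ
            (a' : Module.End ℝ S) ((b' : Module.End ℝ S) * ϕ)
            ((c' : Module.End ℝ S) * ϕ) (d' : Module.End ℝ S) →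
          (Spin.posSpace i S ≠ ⊥ → a = a') ∧ (Spin.negSpace i S ≠ ⊥ → d = d') ∧
            ((k + 1) % 4 ≠ 1 → b = b' ∧ c = c')) := by
  have : Nontrivial S := IsSimpleModule.nontrivial (Spin.Cl (k + 1)) S
  refine ⟨Spin.isCompl_posSpace_negSpace i S, Spin.posSpace_ne_bot_and_negSpace_ne_bot,
    Spin.exists_isOffDiagonalMap i S, fun ϕ hϕ => ⟨?_, ?_, fun φ hφ => ⟨?_, ?_⟩⟩⟩
  · exact Spin.mapsTo_eigenspace_neg_of_anticommute hϕ.anticommute_gen 1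
  · have hmaps := Spin.mapsTo_eigenspace_neg_of_anticommute hϕ.anticommute_gen (-1)
    rwa [neg_neg] at hmaps
  · exact hφ.exists_isBlockMatrix hϕ
  · intro a b c d a' b' c' d' h h'
    exact hϕ.unique_isBlockMatrix h h'
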